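/- **Setting.** For a finite graph $G$ let $\delta(G)$ and $\Delta(G)$ be its minimum and maximum degree, let $\mu_1\ge\mu_2\ge\dots\ge\mu_n$ be the eigenvalues of its adjacency matrix, and let $\lambda(G)=\max_{2\le i\le n}|\mu_i|$. An *expander sequence* is a sequence $(G_n)_{n\ge 1}$ of connected simple graphs, $G_n$ having $n$ vertices, such that $\Delta(G_n)/\delta(G_n)=1+o(1)$ and $\lambda(G_n)=o(\Delta(G_n))$ as $n\to\infty$. Let $q\in(0,1]$, and let initially exactly one vertex $v$ of $G$ be informed. In each round every vertex chooses, independently and uniformly at random, one of its neighbours; a transmission along the chosen edge succeeds with probability $q$, independently of everything else. In *pull*, an uninformed vertex becomes informed in this round if the neighbour it chose was informed before the round and the transmission succeeds. In *push&pull*, if a vertex or the neighbour it chose was informed before the round and the transmission succeeds, then both are informed afterwards. Informed vertices stay informed. Let $T_{pull}(G,v,q)$ and $T_{pp}(G,v,q)$ be the numbers of rounds until all vertices are informed ($\infty$ if this never happens). For $q\in(0,1)$ put $$c_{pull}(q)=\frac1{\log(1+q)}-\frac1{\log(1-q)},\qquad c_{pp}(q)=\frac1{\log(1+2q)}+\frac1{q-\log(1-q)},$$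 with $\log$ the natural logarithm, and let $c_{pull}(1)=\lim_{q\to1}c_{pull}(q)=1/\log 2$ and $c_{pp}(1)=\lim_{q\to1}c_{pp}(q)=1/\log 3$. **Theorem.** Let $0<\varepsilon<1/2$, $q\in(0,1]$, and let $(G_n)$ be an expander sequence. For each $n$ let $\tilde G_n$ be obtained from $G_n$ by deleting edges in such a way that each vertex $v$ keeps at least a $(1/2+\varepsilon)$ fraction of its edges, that is, $d_{\tilde G_n}(v)\ge(1/2+\varepsilon)\,d_{G_n}(v)$. (a) There is a positive function $g(n)=o(\log n)$ such that, uniformly over the initially informed vertex $v$ of $\tilde G_n$, with probability $1-o(1)$ as $n\to\infty$, $$\bigl|T_{pull}(\tilde G_n,v,q)-c_{pull}(q)\log n\bigr|\le g(n).$$ (b) If additionally there is $0<\alpha\le1$ such that $\delta(G_n)\ge\alpha n$ for all sufficiently large $n$, then there is a positive function $g(n)=o(\log n)$ such that, uniformly over the initially informed vertex $v$ of $\tilde G_n$, with probability $1-o(1)$ as $n\to\infty$, $$T_{pp}(\tilde G_n,v,1)\le c_{pp}(1)\log n+g(n).$$ -/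

import Mathlib

open Filter Topology Asymptotics MeasureTheory ProbabilityTheory

namespace RumorSpreading

noncomputable section

/-! ### Expander sequences -/

/-- `λ(G) = max_{2 ≤ i ≤ |V|} |μ_i|`, where `μ_1 ≥ μ_2 ≥ ⋯` are the eigenvalues (with multiplicity)
of the adjacency matrix of `G`. Here `eigenvalues₀` lists them in decreasing order, indexed from
`0`, so the index `0` is the one left out. -/
def secondEigenvalue {V : Type*} [Fintype V] [DecidableEq V] (G : SimpleGraph V)
    [DecidableRel G.Adj] : ℝ :=
  ⨆ i : {i : Fin (Fintype.card V) // i.val ≠ 0}, |(G.isHermitian_adjMatrix ℝ).eigenvalues₀ i.1|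

/-- `G n` is a connected graph on `n` vertices (for `n ≥ 1`; the graph without vertices is
irrelevant), `Δ_n / δ_n = 1 + o(1)` and `λ_n = o(Δ_n)`. -/
structure IsExpanderSequence (G : ∀ n : ℕ, SimpleGraph (Fin n)) [∀ n, DecidableRel (G n).Adj] :
    Prop where
  connected : ∀ n, 1 ≤ n → (G n).Connected
  degree_ratio : Tendsto (fun n => ((G n).maxDegree : ℝ) / ((G n).minDegree : ℝ)) atTop (𝓝 1)
  eigenvalue_small :
    (fun n => secondEigenvalue (G n)) =o[atTop] (fun n => ((G n).maxDegree : ℝ))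

/-- `G'` arises from `G` by deleting edges so that every vertex keeps at least a fraction `r` of
its edges. -/
structure IsEdgeDeletion {V : Type*} [Fintype V] (G G' : SimpleGraph V)
    [DecidableRel G.Adj] [DecidableRel G'.Adj] (r : ℝ) : Prop where
  le : G' ≤ G
  keeps : ∀ v, r * (G.degree v : ℝ) ≤ (G'.degree v : ℝ)

/-! ### The protocols -/

/-- The outcome of one round: each vertex `v` calls the vertex `(ρ v).1`, and `(ρ v).2` says
whether a transmission along this call succeeds. -/
abbrev Round (V : Type*) := V → V × Bool

/-- The vertex called by `v`: a uniformly random neighbour of `v` (an isolated vertex calls only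
itself, which has no effect). -/
def calledVertex {V : Type*} [Fintype V] (G : SimpleGraph V) [DecidableRel G.Adj] (v : V) :
    PMF V :=
  if h : (G.neighborFinset v).Nonempty then PMF.uniformOfFinset (G.neighborFinset v) h
  else PMF.pure v

/-- The law of one round: all calls and all successes are independent, each call goes to a uniformly
random neighbour, each success has probability `q`. -/
def roundMeasure {V : Type*} [Fintype V] [MeasurableSpace V] (G : SimpleGraph V)
    [DecidableRel G.Adj] (q : unitInterval) : Measure (Round V) :=
  Measure.pi fun v => (calledVertex G v).toMeasure.prod (bernoulliMeasure true false q)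

instance {V : Type*} [Fintype V] [MeasurableSpace V] (G : SimpleGraph V)
    [DecidableRel G.Adj] (q : unitInterval) : IsProbabilityMeasure (roundMeasure G q) := by
  unfold roundMeasure; infer_instance

/-- The law of the whole sequence of independent rounds. -/
def processMeasure {V : Type*} [Fintype V] [MeasurableSpace V] (G : SimpleGraph V)
    [DecidableRel G.Adj] (q : unitInterval) : Measure (ℕ → Round V) :=
  Measure.infinitePi fun _ : ℕ => roundMeasure G q

/-- A protocol: the new set of informed vertices, given the outcome of the round and the set of
vertices informed before it. -/
abbrev Protocol (V : Type*) := Round V → Set V → Set V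

/-- *pull*: an uninformed vertex becomes informed if it calls an informed vertex and the
transmission succeeds. -/
def pull {V : Type*} : Protocol V := fun ρ I =>
  I ∪ {u | (ρ u).1 ∈ I ∧ (ρ u).2 = true}

/-- *push&pull*: if one of the two ends of a call is informed, and the transmission along this call
succeeds, then afterwards both are informed. -/
def pushPull {V : Type*} : Protocol V := fun ρ I =>
  I ∪ {u | (ρ u).1 ∈ I ∧ (ρ u).2 = true} ∪ {u | ∃ w ∈ I, (ρ w).1 = u ∧ (ρ w).2 = true}

/-- The set of informed vertices after `t` rounds, starting from the single informed vertex `v`. -/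
def informed {V : Type*} (P : Protocol V) (v : V) (ω : ℕ → Round V) : ℕ → Set V
  | 0 => {v}
  | t + 1 => P (ω t) (informed P v ω t)

/-- The runtime: the number of rounds until all vertices are informed (`⊤` if this never
happens). -/
def runtime {V : Type*} (P : Protocol V) (v : V) (ω : ℕ → Round V) : ℕ∞ :=
  ⨅ (t : ℕ) (_ : informed P v ω t = Set.univ), (t : ℕ∞)

/-! ### The constants -/

/-- `c_pull(q)`, the value at `q = 1` being the limit for `q → 1`. -/
def cPull (q : ℝ) : ℝ :=
  if q = 1 then 1 / Real.log 2 else 1 / Real.log (1 + q) - 1 / Real.log (1 - q)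

/-- `c_pp(q)`, the value at `q = 1` being the limit for `q → 1`. -/
def cPushPull (q : ℝ) : ℝ :=
  if q = 1 then 1 / Real.log 3 else 1 / Real.log (1 + 2 * q) + 1 / (q - Real.log (1 - q))

theorem tendsto_log_one_sub : Tendsto (fun q : ℝ => Real.log (1 - q)) (𝓝[<] 1) atBot := by
  refine Real.tendsto_log_nhdsGT_zero.comp ?_
  refine tendsto_nhdsWithin_iff.2 ⟨?_, ?_⟩
  · have h : Tendsto (fun q : ℝ => 1 - q) (𝓝 1) (𝓝 (1 - 1)) := tendsto_const_nhds.sub tendsto_id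
    rw [sub_self] at h
    exact h.mono_left nhdsWithin_le_nhds
  · filter_upwards [self_mem_nhdsWithin] with q hq
    simpa using hq

theorem cPull_one_isLimit : Tendsto cPull (𝓝[<] 1) (𝓝 (cPull 1)) := by
  have h1 : Tendsto (fun q : ℝ => 1 / Real.log (1 + q)) (𝓝[<] 1) (𝓝 (1 / Real.log (1 + 1))) := by
    refine Tendsto.mono_left (ContinuousAt.tendsto ?_) nhdsWithin_le_nhds
    refine continuousAt_const.div ?_ (by norm_num)
    exact ContinuousAt.log (by fun_prop) (by norm_num)
  have h2 : Tendsto (fun q : ℝ => 1 / Real.log (1 - q)) (𝓝[<] 1) (𝓝 0) := by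
    simp only [one_div]
    exact tendsto_inv_atBot_zero.comp tendsto_log_one_sub
  have h3 := h1.sub h2
  have hv : cPull 1 = 1 / Real.log (1 + 1) - 0 := by norm_num [cPull]
  rw [hv]
  refine h3.congr' ?_
  filter_upwards [self_mem_nhdsWithin] with q hq
  simp [cPull, ne_of_lt (Set.mem_Iio.1 hq)]

theorem cPushPull_one_isLimit : Tendsto cPushPull (𝓝[<] 1) (𝓝 (cPushPull 1)) := by
  have h1 : Tendsto (fun q : ℝ => 1 / Real.log (1 + 2 * q)) (𝓝[<] 1)
      (𝓝 (1 / Real.log (1 + 2 * 1))) := by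
    refine Tendsto.mono_left (ContinuousAt.tendsto (f := fun q : ℝ => 1 / Real.log (1 + 2 * q)) ?_)
      nhdsWithin_le_nhds
    refine continuousAt_const.div ?_ (by norm_num)
    exact ContinuousAt.log (by fun_prop) (by norm_num)
  have h2 : Tendsto (fun q : ℝ => 1 / (q - Real.log (1 - q))) (𝓝[<] 1) (𝓝 0) := by
    have hq : Tendsto (fun q : ℝ => q) (𝓝[<] 1) (𝓝 1) := nhdsWithin_le_nhds
    have h : Tendsto (fun q : ℝ => q + -Real.log (1 - q)) (𝓝[<] 1) atTop :=
      hq.add_atTop (tendsto_neg_atBot_atTop.comp tendsto_log_one_sub)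
    simp only [one_div, sub_eq_add_neg (_ : ℝ) (Real.log _)]
    exact tendsto_inv_atTop_zero.comp h
  have h3 := h1.add h2
  have hv : cPushPull 1 = 1 / Real.log (1 + 2 * 1) + 0 := by norm_num [cPushPull]
  rw [hv]
  refine h3.congr' ?_
  filter_upwards [self_mem_nhdsWithin] with q hq
  simp [cPushPull, ne_of_lt (Set.mem_Iio.1 hq)]

end

end RumorSpreading

namespace RumorSpreading

noncomputable section

/-! ### The transition operator of a protocol -/

/-! Write `Δ` for the maximum degree of the original graph. Near-regularity and the small second
eigenvalue give a mixing estimate: a set `S` has inner degree sum at most `(|S|/n + o(1)) Δ |S|`.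
Deleting edges preserves this upper bound. Since every vertex keeps more than half of its edges, two
facts survive the deletion (`WellSpread`): small sets send almost all their remaining edges outside,
and a set of at most half of the vertices has at least `(ε/2) Δ |S|` boundary edges.

Degrees in the remaining graph may differ by a factor of about two, so vertices are weighted to make
the growth rate independent of them. For pull the weight is the degree `d`: an uninformed `u` calls
into `I` with probability `d_I(u)/d(u)`, so the expected gain of volume is `q` times the number of
boundary edges, and small sets grow by a factor close to `1 + q`. For push&pull with `q = 1` the
weight is `√d`: an edge from informed `v` to uninformed `u` contributes `√d(u) (1/d(u) + 1/d(v)) ≥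
2/√d(v)` by AM-GM, so small sets grow by a factor close to `3`, up to several calls reaching the
same vertex. The latter effect is bounded by the sum of the squared inner degrees.

Means become high-probability statements without exponential concentration. Independence of the
calls bounds the variance of the gain, so the reciprocal weight has conditional mean at most a
factor `β < 1` times its old value (`integral_inv_le`). Iterating this drift and applying Markov's
inequality (`transition_iterate_ind_le`) bounds the time needed to leave a range of sizes.

The upper bound joins four phases for a small constant `x`: from one vertex to `1/x`, to `x n`, to
all but `x n`, to all. In the first and third a crude constant rate suffices, and their lengths are
arbitrarily small multiples of `log n`. The second runs at the sharp rate above. In the last,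
uninformed vertices see mostly informed neighbours on average, so pull alone shrinks their number by
a factor close to `1 - q`; for `q = 1` this factor is arbitrarily small and the phase costs `o(log
n)`.

For the lower bound for pull, the expected volume grows by at most `1 + q` per round, so half of the
vertices are still uninformed shortly before `log n / log (1 + q)`. Each of these then needs a
successful transmission of its own, and the probability that all have one within `t` rounds is at
most `exp (-(1 - q)^t n / 2)`. -/

theorem informed_congr {V : Type*} (P : Protocol V) (v : V) {ω ω' : ℕ → Round V} (t : ℕ)
    (h : ∀ s < t, ω s = ω' s) : informed P v ω t = informed P v ω' t := by
  induction t with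
  | zero => rfl
  | succ t ih =>
    simp only [informed]
    rw [ih fun s hs => h s (by omega), h t (by omega)]

instance {V : Type*} [Fintype V] [MeasurableSpace V] (G : SimpleGraph V)
    [DecidableRel G.Adj] (q : unitInterval) : IsProbabilityMeasure (processMeasure G q) := by
  unfold processMeasure; infer_instance

section Transition

variable {V : Type*} [Fintype V] [MeasurableSpace V] [MeasurableSingletonClass V]

/-- The transition operator: the expected value of `F` after one round started from `I`. -/
def transition (P : Protocol V) (μ : Measure (Round V)) (F : Set V → ℝ) (I : Set V) : ℝ :=
  ∫ ρ, F (P ρ I) ∂μ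

theorem integrable_round (μ : Measure (Round V)) [IsFiniteMeasure μ] (f : Round V → ℝ) :
    Integrable f μ := Integrable.of_finite

theorem transition_mono (P : Protocol V) (μ : Measure (Round V)) [IsFiniteMeasure μ]
    {F F' : Set V → ℝ} (h : ∀ I, F I ≤ F' I) (I : Set V) :
    transition P μ F I ≤ transition P μ F' I :=
  integral_mono (integrable_round μ _) (integrable_round μ _) fun _ => h _

theorem transition_iterate_mono (P : Protocol V) (μ : Measure (Round V)) [IsFiniteMeasure μ]
    (t : ℕ) {F F' : Set V → ℝ} (h : ∀ I, F I ≤ F' I) (I : Set V) :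
    (transition P μ)^[t] F I ≤ (transition P μ)^[t] F' I := by
  induction t generalizing F F' with
  | zero => exact h I
  | succ t ih => exact ih fun J => transition_mono P μ h J

theorem transition_iterate_add_const (P : Protocol V) (μ : Measure (Round V))
    [IsProbabilityMeasure μ] (t : ℕ) (F : Set V → ℝ) (c : ℝ) (I : Set V) :
    (transition P μ)^[t] (fun J => F J + c) I = (transition P μ)^[t] F I + c := by
  induction t generalizing F with
  | zero => rfl
  | succ t ih =>
    have h : transition P μ (fun J => F J + c) = fun J => transition P μ F J + c := by
      funext J
      simp [transition, integral_add (integrable_round μ _) (integrable_round μ _)]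
    rw [Function.iterate_succ_apply, h, ih, Function.iterate_succ_apply]

theorem transition_iterate_le_one (P : Protocol V) (μ : Measure (Round V))
    [IsProbabilityMeasure μ] (t : ℕ) {F : Set V → ℝ} (h : ∀ I, F I ≤ 1) (I : Set V) :
    (transition P μ)^[t] F I ≤ 1 := by
  induction t generalizing F with
  | zero => exact h I
  | succ t ih =>
    refine ih fun J => ?_
    calc transition P μ F J ≤ transition P μ (fun _ => 1) J := transition_mono P μ h J
      _ = 1 := by simp [transition]

/-- The indicator function of a family of sets, as a function to the reals. -/
def ind (A : Set (Set V)) : Set V → ℝ := A.indicator 1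

/-- If a first stage reaches `A` and the second stage reaches the complement of `B` from `A`, the
failure probabilities add up. -/
theorem transition_iterate_add_le (P : Protocol V) (μ : Measure (Round V)) [IsProbabilityMeasure μ]
    (A B : Set (Set V)) (s t : ℕ) (I : Set V) {c : ℝ} (hc : 0 ≤ c)
    (h : ∀ J ∈ A, (transition P μ)^[t] (ind B) J ≤ c) :
    (transition P μ)^[s + t] (ind B) I ≤ (transition P μ)^[s] (ind Aᶜ) I + c := by
  rw [Function.iterate_add_apply, ← transition_iterate_add_const]
  refine transition_iterate_mono P μ s (fun J => ?_) I
  by_cases hJ : J ∈ A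
  · simpa [ind, hJ] using h J hJ
  · have := transition_iterate_le_one P μ t (F := ind B)
      (fun I => Set.indicator_apply_le' (fun _ => le_rfl) fun _ => zero_le_one) J
    simp only [ind, Set.mem_compl_iff, hJ, not_false_eq_true, Set.indicator_of_mem, Pi.one_apply]
    simp only [ind] at this
    linarith

/-- A family of sets that no round can leave. -/
def Absorbing (P : Protocol V) (R : Set (Set V)) : Prop := ∀ ρ, ∀ I ∈ R, P ρ I ∈ R

/-- The supermartingale argument: since rounds never leave `R`, the one-step bound can be applied
again at every later time. -/
theorem transition_iterate_drift (P : Protocol V) (μ : Measure (Round V)) [IsFiniteMeasure μ]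
    {R : Set (Set V)} (hR : Absorbing P R) {H : Set V → ℝ} {β : ℝ} (hβ : 0 ≤ β)
    (hd : ∀ I ∈ R, transition P μ H I ≤ β * H I) (t : ℕ) {I : Set V} (hI : I ∈ R) :
    (transition P μ)^[t] H I ≤ β ^ t * H I := by
  induction t generalizing I with
  | zero => simp
  | succ t ih =>
    rw [Function.iterate_succ_apply']
    calc transition P μ ((transition P μ)^[t] H) I
        ≤ ∫ ρ, β ^ t * H (P ρ I) ∂μ :=
          integral_mono (integrable_round μ _) (integrable_round μ _) fun ρ => ih (hR ρ I hI)
      _ = β ^ t * transition P μ H I := integral_const_mul _ _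
      _ ≤ β ^ t * (β * H I) := by gcongr; exact hd I hI
      _ = β ^ (t + 1) * H I := by ring

theorem transition_iterate_mono_on (P : Protocol V) (μ : Measure (Round V)) [IsFiniteMeasure μ]
    {R : Set (Set V)} (hR : Absorbing P R) (t : ℕ) {F F' : Set V → ℝ} (h : ∀ I ∈ R, F I ≤ F' I)
    {I : Set V} (hI : I ∈ R) : (transition P μ)^[t] F I ≤ (transition P μ)^[t] F' I := by
  induction t generalizing F F' with
  | zero => exact h I hI
  | succ t ih =>
    exact ih fun J hJ => integral_mono (integrable_round μ _) (integrable_round μ _)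
      fun ρ => h _ (hR ρ J hJ)

/-- If `h` contracts in mean by the factor `β` until `B` is reached, then `B` is reached
exponentially fast. -/
theorem transition_iterate_ind_le (P : Protocol V) (μ : Measure (Round V)) [IsFiniteMeasure μ]
    {R B : Set (Set V)} (hR : Absorbing P R) (hB : Absorbing P B) {h : Set V → ℝ} {β m : ℝ}
    (hβ : 0 ≤ β) (hm : 0 < m) (h0 : ∀ I, 0 ≤ h I) (hlow : ∀ I ∈ R, I ∉ B → m ≤ h I)
    (hd : ∀ I ∈ R, I ∉ B → transition P μ h I ≤ β * h I) (t : ℕ) {I : Set V} (hI : I ∈ R) :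
    (transition P μ)^[t] (ind Bᶜ) I ≤ β ^ t * (h I / m) := by
  classical
  -- Setting `h / m` to zero on `B` extends the drift from the complement of `B` to all of `R`,
  -- because `B` is absorbing. Off `B` it is at least `1`, so it dominates the indicator of failure;
  -- this is Markov's inequality.
  set H : Set V → ℝ := Bᶜ.indicator fun J => h J / m with hH
  have hH0 : ∀ J, 0 ≤ h J / m := fun J => div_nonneg (h0 J) hm.le
  have hHle : ∀ J, H J ≤ h J / m := fun J => Set.indicator_le_self' (fun _ _ => hH0 _) J
  calc (transition P μ)^[t] (ind Bᶜ) I ≤ (transition P μ)^[t] H I := by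
        refine transition_iterate_mono_on P μ hR t (fun J hJR => ?_) hI
        by_cases hJ : J ∈ B
        · simp [ind, hH, hJ]
        · simpa [ind, hH, hJ] using (one_le_div hm).2 (hlow J hJR hJ)
    _ ≤ β ^ t * H I := by
        refine transition_iterate_drift P μ hR hβ (fun J hJ => ?_) t hI
        by_cases hJB : J ∈ B
        · have : ∀ ρ, H (P ρ J) = 0 := fun ρ => by simp [hH, hB ρ J hJB]
          simp [transition, this, show H J = 0 by simp [hH, hJB]]
        · calc transition P μ H J ≤ transition P μ (fun J => h J / m) J :=
                transition_mono P μ hHle J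
            _ = transition P μ h J / m := integral_div _ _
            _ ≤ β * h J / m := by gcongr; exact hd J hJ hJB
            _ = β * H J := by simp [hH, hJB, mul_div_assoc]
    _ ≤ β ^ t * (h I / m) := by gcongr; exact hHle I

/-- The expectation of a function of the set informed after `t` rounds. -/
theorem integral_informed (G : SimpleGraph V) [DecidableRel G.Adj] (q : unitInterval)
    (P : Protocol V) (v : V) (t : ℕ) (F : Set V → ℝ) :
    ∫ ω, F (informed P v ω t) ∂(processMeasure G q) =
      (transition P (roundMeasure G q))^[t] F {v} := by
  induction t generalizing F with
  | zero => simp [informed, processMeasure]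
  | succ t ih =>
    rw [Function.iterate_succ_apply, ← ih]
    -- The set informed after `t` rounds depends on these rounds only, so the later ones may be
    -- filled with dummy values. This exhibits it as a function of a variable independent of round
    -- `t`, and Fubini applies.
    let ext : (Finset.range t → Round V) → ℕ → Round V := fun η s =>
      if hs : s ∈ Finset.range t then η ⟨s, hs⟩ else fun v => (v, false)
    have hext : ∀ ω : ℕ → Round V,
        informed P v ω t = informed P v (ext ((Finset.range t).restrict ω)) t := fun ω =>
      informed_congr P v t fun s hs => by simp [ext, hs]
    have hind : IndepFun (fun ω : ℕ → Round V => (Finset.range t).restrict ω) (fun ω => ω t)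
        (processMeasure G q) := by
      have h := iIndepFun.indepFun_finset (Finset.range t) {t} (by simp)
        (iIndepFun_infinitePi (P := fun _ : ℕ => roundMeasure G q) (X := fun _ ρ => ρ)
          fun _ => measurable_id) (by fun_prop)
      exact h.comp (φ := id) (ψ := fun x : ({t} : Finset ℕ) → Round V => x ⟨t, by simp⟩)
        measurable_id (measurable_pi_apply _)
    have hmap := (indepFun_iff_map_prod_eq_prod_map_map (by fun_prop)
      (measurable_pi_apply t).aemeasurable).1 hind
    have hev : (processMeasure G q).map (fun ω => ω t) = roundMeasure G q :=
      Measure.infinitePi_map_eval _ t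
    have : IsProbabilityMeasure ((processMeasure G q).map
      fun ω => (Finset.range t).restrict ω) := Measure.isProbabilityMeasure_map (by fun_prop)
    rw [hev] at hmap
    let f : (Finset.range t → Round V) × Round V → ℝ := fun p =>
      F (P p.2 (informed P v (ext p.1) t))
    calc ∫ ω, F (informed P v ω (t + 1)) ∂(processMeasure G q)
        = ∫ ω, f ((Finset.range t).restrict ω, ω t) ∂(processMeasure G q) := by
          refine integral_congr_ae (ae_of_all _ fun ω => ?_)
          simp only [f, informed]
          rw [← hext]
      _ = ∫ p, f p ∂((processMeasure G q).map fun ω => ((Finset.range t).restrict ω, ω t)) :=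
          (integral_map (by fun_prop) (by fun_prop)).symm
      _ = ∫ η, ∫ ρ, f (η, ρ) ∂(roundMeasure G q)
            ∂((processMeasure G q).map fun ω => (Finset.range t).restrict ω) := by
          rw [hmap, integral_prod _ Integrable.of_finite]
      _ = ∫ ω, transition P (roundMeasure G q) F (informed P v ω t) ∂(processMeasure G q) := by
          rw [integral_map (by fun_prop) Integrable.of_finite.aestronglyMeasurable]
          refine integral_congr_ae (ae_of_all _ fun ω => ?_)
          simp only [f, transition]
          rw [← hext]

theorem measurableSet_informed (P : Protocol V) (v : V) (t : ℕ) (A : Set (Set V)) :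
    MeasurableSet {ω : ℕ → Round V | informed P v ω t ∈ A} := by
  let ext : (Finset.range t → Round V) → ℕ → Round V := fun η s =>
    if hs : s ∈ Finset.range t then η ⟨s, hs⟩ else fun v => (v, false)
  have : {ω : ℕ → Round V | informed P v ω t ∈ A} =
      (fun ω => (Finset.range t).restrict ω) ⁻¹' {η | informed P v (ext η) t ∈ A} := by
    ext ω
    have : informed P v ω t = informed P v (ext ((Finset.range t).restrict ω)) t :=
      informed_congr P v t fun s hs => by simp [ext, hs]
    simp [this]
  rw [this]
  exact (show Measurable _ by fun_prop) (Set.toFinite _).measurableSet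

theorem measureReal_informed (G : SimpleGraph V) [DecidableRel G.Adj] (q : unitInterval)
    (P : Protocol V) (v : V) (t : ℕ) (A : Set (Set V)) :
    (processMeasure G q).real {ω | informed P v ω t ∈ A} =
      (transition P (roundMeasure G q))^[t] (ind A) {v} := by
  rw [← integral_informed, ← integral_indicator_one (measurableSet_informed P v t A)]
  rfl

end Transition

/-! ### The spectral estimate -/

section Spectral

open Matrix

variable {V : Type*} [Fintype V]

theorem sum_sq_adjMatrix_mulVec_le (G : SimpleGraph V) [DecidableRel G.Adj] (x : V → ℝ) :
    ∑ u, (G.adjMatrix ℝ *ᵥ x) u ^ 2 ≤ (G.maxDegree : ℝ) ^ 2 * ∑ u, x u ^ 2 := by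
  classical
  have hdeg : ∀ u, ∑ v, G.adjMatrix ℝ u v ≤ G.maxDegree := fun u => by
    have h := G.adjMatrix_mulVec_const_apply (α := ℝ) (a := 1) (v := u)
    simp only [mulVec, dotProduct, Function.const, mul_one] at h
    rw [h]
    exact_mod_cast G.degree_le_maxDegree u
  have ha0 : ∀ u v, 0 ≤ G.adjMatrix ℝ u v := fun u v => by
    rw [SimpleGraph.adjMatrix_apply]; split_ifs <;> simp
  have ha2 : ∀ u v, G.adjMatrix ℝ u v ^ 2 = G.adjMatrix ℝ u v := fun u v => by
    rw [SimpleGraph.adjMatrix_apply]; split_ifs <;> simp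
  calc ∑ u, (G.adjMatrix ℝ *ᵥ x) u ^ 2
      ≤ ∑ u, (G.maxDegree : ℝ) * ∑ v, G.adjMatrix ℝ u v * x v ^ 2 := by
        -- Cauchy-Schwarz with entries `a = a²`: `(∑ a x)² ≤ (∑ a)(∑ a x²)`.
        refine Finset.sum_le_sum fun u _ => ?_
        have h := Finset.sum_mul_sq_le_sq_mul_sq Finset.univ (fun v => G.adjMatrix ℝ u v)
          (fun v => G.adjMatrix ℝ u v * x v)
        have e1 : ∀ v, G.adjMatrix ℝ u v * (G.adjMatrix ℝ u v * x v) =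
            G.adjMatrix ℝ u v * x v := fun v => by rw [← mul_assoc, ← sq, ha2]
        simp only [e1, mul_pow, ha2] at h
        refine h.trans (mul_le_mul_of_nonneg_right (hdeg u) ?_)
        exact Finset.sum_nonneg fun v _ => mul_nonneg (ha0 u v) (sq_nonneg _)
    _ = (G.maxDegree : ℝ) * ∑ v, (∑ u, G.adjMatrix ℝ v u) * x v ^ 2 := by
        rw [← Finset.mul_sum, Finset.sum_comm]
        simp only [Finset.sum_mul, SimpleGraph.adjMatrix_apply, G.adj_comm]
    _ ≤ (G.maxDegree : ℝ) * ∑ v, (G.maxDegree : ℝ) * x v ^ 2 := by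
        gcongr with v
        exact hdeg v
    _ = _ := by rw [← Finset.mul_sum]; ring

variable [DecidableEq V]

/-- Parseval in the eigenvector basis; by symmetry of `A`, the coefficients of `A x` are those of
`x` times the eigenvalues. -/
theorem sum_sq_mulVec_eq {A : Matrix V V ℝ} (hA : A.IsHermitian) (x : V → ℝ) :
    ∑ u, (A *ᵥ x) u ^ 2 =
      ∑ i, hA.eigenvalues i ^ 2 * (∑ u, hA.eigenvectorBasis i u * x u) ^ 2 ∧
    ∑ i, (∑ u, hA.eigenvectorBasis i u * x u) ^ 2 = ∑ u, x u ^ 2 := by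
  have key : ∀ y : V → ℝ, ∑ i, (∑ u, hA.eigenvectorBasis i u * y u) ^ 2 = ∑ u, y u ^ 2 := by
    intro y
    have h := hA.eigenvectorBasis.sum_sq_norm_inner_right (WithLp.toLp 2 y)
    simpa [EuclideanSpace.norm_sq_eq, PiLp.inner_apply, mul_comm] using h
  refine ⟨?_, key x⟩
  rw [← key]
  refine Finset.sum_congr rfl fun i _ => ?_
  rw [← mul_pow]
  congr 1
  have h1 : (⇑(hA.eigenvectorBasis i) : V → ℝ) ⬝ᵥ (A *ᵥ x) =
      (A *ᵥ ⇑(hA.eigenvectorBasis i)) ⬝ᵥ x := by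
    rw [dotProduct_mulVec, ← mulVec_transpose]
    congr 2
  rw [hA.mulVec_eigenvectorBasis i, smul_dotProduct] at h1
  exact h1

/-- The eigenvalue `λ(G)` controls the adjacency matrix on the vectors orthogonal to the constant
ones, up to the irregularity of the degrees. -/
theorem sum_sq_adjMatrix_mulVec_le_of_sum_eq_zero [Nonempty V] (G : SimpleGraph V)
    [DecidableRel G.Adj] {x : V → ℝ} (hx : ∑ u, x u = 0) :
    ∑ u, (G.adjMatrix ℝ *ᵥ x) u ^ 2 ≤
      ((G.maxDegree : ℝ) ^ 2 - (G.minDegree : ℝ) ^ 2 + 2 * secondEigenvalue G ^ 2) *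
        ∑ u, x u ^ 2 := by
  set A := G.adjMatrix ℝ
  set hA := G.isHermitian_adjMatrix ℝ
  set L := secondEigenvalue G
  set Δ : ℝ := ((G.maxDegree : ℕ) : ℝ)
  set δ : ℝ := ((G.minDegree : ℕ) : ℝ)
  set n : ℝ := ((Fintype.card V : ℕ) : ℝ)
  have hn : 0 < n := by simpa [n] using Fintype.card_pos (α := V)
  -- The same equivalence relates `eigenvalues` to `eigenvalues₀`, so `i₀` is exactly the index left
  -- out in `secondEigenvalue`.
  let e : Fin (Fintype.card V) ≃ V := Fintype.equivOfCardEq (Fintype.card_fin _)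
  let i₀ : V := e ⟨0, Fintype.card_pos⟩
  let w : V → ℝ := ⇑(hA.eigenvectorBasis i₀)
  have hlam : ∀ i, i ≠ i₀ → hA.eigenvalues i ^ 2 ≤ L ^ 2 := by
    intro i hi
    have h0 : (e.symm i).val ≠ 0 := fun h => hi <| by
      rw [← e.apply_symm_apply i]; congr 1; exact Fin.ext h
    have hle : |hA.eigenvalues i| ≤ L :=
      le_ciSup (f := fun j : {j : Fin (Fintype.card V) // j.val ≠ 0} => |hA.eigenvalues₀ j.1|)
        (Set.finite_range _).bddAbove ⟨e.symm i, h0⟩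
    rw [← sq_abs (hA.eigenvalues i)]
    gcongr
  have hexp : ∀ y : V → ℝ, ∑ u, (A *ᵥ y) u ^ 2 ≤
      hA.eigenvalues i₀ ^ 2 * (∑ u, w u * y u) ^ 2 + L ^ 2 * ∑ u, y u ^ 2 := by
    intro y
    obtain ⟨h1, h2⟩ := sum_sq_mulVec_eq hA y
    rw [h1, ← h2, ← Finset.add_sum_erase _ _ (Finset.mem_univ i₀), Finset.mul_sum]
    gcongr
    refine (Finset.sum_le_sum fun i hi => mul_le_mul_of_nonneg_right
      (hlam i (Finset.ne_of_mem_erase hi)) (sq_nonneg _)).trans ?_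
    exact Finset.sum_le_sum_of_subset_of_nonneg (Finset.erase_subset _ _)
      fun i _ _ => by positivity
  have hw : ∑ u, w u ^ 2 = 1 := by
    have h := hA.eigenvectorBasis.orthonormal.1 i₀
    have h2 := EuclideanSpace.norm_sq_eq (hA.eigenvectorBasis i₀)
    rw [h] at h2
    simpa [w] using h2.symm
  have hμ : hA.eigenvalues i₀ ^ 2 ≤ Δ ^ 2 := by
    have h := sum_sq_adjMatrix_mulVec_le G w
    have h2 : A *ᵥ w = hA.eigenvalues i₀ • w := hA.mulVec_eigenvectorBasis i₀
    change ∑ u, (A *ᵥ w) u ^ 2 ≤ _ at h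
    rw [h2] at h
    simpa [mul_pow, ← Finset.mul_sum, hw] using h
  set s := ∑ u, w u
  -- Testing with the constant vector, whose image is the degree vector, shows that the leading
  -- eigenvector is nearly parallel to it: `s² / n` is close to `1` when the graph is nearly
  -- regular.
  have hone : n * δ ^ 2 ≤ Δ ^ 2 * s ^ 2 + L ^ 2 * n := by
    have h := hexp (fun _ => 1)
    have h1 : ∀ u, (A *ᵥ fun _ => (1 : ℝ)) u = G.degree u := fun u => by
      have h := G.adjMatrix_mulVec_const_apply (α := ℝ) (a := 1) (v := u)
      rwa [mul_one] at h
    have h2 : n * δ ^ 2 ≤ ∑ u, (A *ᵥ fun _ => (1 : ℝ)) u ^ 2 := by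
      calc n * δ ^ 2 = ∑ _u : V, δ ^ 2 := by simp [n]
        _ ≤ _ := by
          refine Finset.sum_le_sum fun u _ => ?_
          rw [h1]
          have : δ ≤ G.degree u := Nat.cast_le.2 (G.minDegree_le_degree u)
          gcongr
    simp only [mul_one, one_pow, Finset.sum_const, Finset.card_univ, nsmul_eq_mul] at h
    calc n * δ ^ 2 ≤ _ := h2
      _ ≤ _ := h
      _ ≤ _ := by gcongr
  -- Since `x` is orthogonal to the constants, only the part of `w` orthogonal to them matters, and
  -- its squared norm is `1 - s² / n`.
  have hproj : (∑ u, w u * x u) ^ 2 ≤ (1 - s ^ 2 / n) * ∑ u, x u ^ 2 := by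
    have h1 : ∑ u, w u * x u = ∑ u, (w u - s / n) * x u := by
      simp only [sub_mul, Finset.sum_sub_distrib, ← Finset.mul_sum, hx, mul_zero, sub_zero]
    have h2 : ∑ u, (w u - s / n) ^ 2 = 1 - s ^ 2 / n := by
      have : ∀ u, (w u - s / n) ^ 2 = w u ^ 2 - 2 * (s / n) * w u + (s / n) ^ 2 := fun u => by ring
      simp only [this, Finset.sum_add_distrib, Finset.sum_sub_distrib, ← Finset.mul_sum, hw,
        Finset.sum_const, Finset.card_univ, nsmul_eq_mul]
      change 1 - 2 * (s / n) * s + n * (s / n) ^ 2 = _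
      field_simp; ring
    rw [h1, ← h2]
    exact Finset.sum_mul_sq_le_sq_mul_sq _ _ _
  have hX : 0 ≤ ∑ u, x u ^ 2 := Finset.sum_nonneg fun _ _ => sq_nonneg _
  have hgap : Δ ^ 2 * (1 - s ^ 2 / n) ≤ Δ ^ 2 - δ ^ 2 + L ^ 2 := by
    have : δ ^ 2 ≤ Δ ^ 2 * (s ^ 2 / n) + L ^ 2 := by
      rw [← mul_le_mul_iff_of_pos_left hn]
      refine hone.trans (le_of_eq ?_)
      field_simp
    linarith
  calc ∑ u, (A *ᵥ x) u ^ 2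
      ≤ hA.eigenvalues i₀ ^ 2 * (∑ u, w u * x u) ^ 2 + L ^ 2 * ∑ u, x u ^ 2 := hexp x
    _ ≤ Δ ^ 2 * ((1 - s ^ 2 / n) * ∑ u, x u ^ 2) + L ^ 2 * ∑ u, x u ^ 2 := by gcongr
    _ = (Δ ^ 2 * (1 - s ^ 2 / n)) * ∑ u, x u ^ 2 + L ^ 2 * ∑ u, x u ^ 2 := by ring
    _ ≤ (Δ ^ 2 - δ ^ 2 + L ^ 2) * ∑ u, x u ^ 2 + L ^ 2 * ∑ u, x u ^ 2 := by gcongr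
    _ = _ := by ring

end Spectral

/-! ### Weights of vertex sets and edge distribution -/

section Weights

variable {V : Type*}

/-- The indicator function of a vertex set. -/
def chi (S : Set V) (u : V) : ℝ := S.indicator 1 u

theorem chi_of_mem {S : Set V} {u : V} (h : u ∈ S) : chi S u = 1 := by simp [chi, h]

theorem chi_of_notMem {S : Set V} {u : V} (h : u ∉ S) : chi S u = 0 := by simp [chi, h]

theorem chi_nonneg (S : Set V) (u : V) : 0 ≤ chi S u := by
  by_cases h : u ∈ S <;> simp [chi, h]

theorem chi_le_one (S : Set V) (u : V) : chi S u ≤ 1 := by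
  by_cases h : u ∈ S <;> simp [chi, h]

theorem chi_sq (S : Set V) (u : V) : chi S u ^ 2 = chi S u := by
  by_cases h : u ∈ S <;> simp [chi, h]

theorem chi_compl (S : Set V) (u : V) : chi Sᶜ u = 1 - chi S u := by
  by_cases h : u ∈ S <;> simp [chi, h]

theorem chi_mono {S T : Set V} (h : S ⊆ T) (u : V) : chi S u ≤ chi T u :=
  Set.indicator_le_indicator_of_subset h (fun _ => zero_le_one) u

theorem adjMatrix_nonneg (H : SimpleGraph V) [DecidableRel H.Adj] (u v : V) :
    0 ≤ H.adjMatrix ℝ u v := by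
  rw [SimpleGraph.adjMatrix_apply]; split_ifs <;> simp

theorem adjMatrix_symm (H : SimpleGraph V) [DecidableRel H.Adj] (u v : V) :
    H.adjMatrix ℝ u v = H.adjMatrix ℝ v u := by
  simp [SimpleGraph.adjMatrix_apply, H.adj_comm]

variable [Fintype V]

/-- The total weight of a vertex set. -/
def wt (s : V → ℝ) (S : Set V) : ℝ := ∑ u, chi S u * s u

/-- The number of elements of a vertex set. -/
def sz (S : Set V) : ℝ := ∑ u, chi S u

theorem wt_mono_set {s : V → ℝ} (hs : ∀ u, 0 ≤ s u) {S T : Set V} (h : S ⊆ T) :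
    wt s S ≤ wt s T :=
  Finset.sum_le_sum fun u _ => mul_le_mul_of_nonneg_right (chi_mono h u) (hs u)

theorem wt_mono {s s' : V → ℝ} (h : ∀ u, s u ≤ s' u) (S : Set V) : wt s S ≤ wt s' S :=
  Finset.sum_le_sum fun u _ => mul_le_mul_of_nonneg_left (h u) (chi_nonneg S u)

theorem wt_const (c : ℝ) (S : Set V) : wt (fun _ => c) S = c * sz S := by
  simp only [wt, sz, Finset.mul_sum, mul_comm]

theorem wt_nonneg {s : V → ℝ} (hs : ∀ u, 0 ≤ s u) (S : Set V) : 0 ≤ wt s S :=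
  Finset.sum_nonneg fun u _ => mul_nonneg (chi_nonneg S u) (hs u)

theorem wt_add_compl (s : V → ℝ) (S : Set V) : wt s S + wt s Sᶜ = ∑ u, s u := by
  simp only [wt, ← Finset.sum_add_distrib, chi_compl]
  exact Finset.sum_congr rfl fun u _ => by ring

theorem sz_mono {S T : Set V} (h : S ⊆ T) : sz S ≤ sz T :=
  Finset.sum_le_sum fun u _ => chi_mono h u

theorem sz_nonneg (S : Set V) : 0 ≤ sz S := Finset.sum_nonneg fun u _ => chi_nonneg S u

theorem sz_compl (S : Set V) : sz Sᶜ = Fintype.card V - sz S := by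
  simp [sz, chi_compl]

theorem one_le_sz {S : Set V} (h : S.Nonempty) : 1 ≤ sz S := by
  obtain ⟨v, hv⟩ := h
  rw [← chi_of_mem hv]
  exact Finset.single_le_sum (fun u _ => chi_nonneg S u) (Finset.mem_univ v)

theorem sz_univ : sz (Set.univ : Set V) = Fintype.card V := by simp [sz, chi]

theorem wt_singleton (s : V → ℝ) (v : V) : wt s {v} = s v := by
  classical
  simp [wt, chi, Set.indicator_apply]

variable (H : SimpleGraph V) [DecidableRel H.Adj]

/-- The number of neighbours of `u` in `S`. -/
def degIn (S : Set V) (u : V) : ℝ := ∑ v, H.adjMatrix ℝ u v * chi S v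

/-- The degree as a real-valued function. -/
def rdeg (u : V) : ℝ := H.degree u

theorem sum_adjMatrix (u : V) : ∑ v, H.adjMatrix ℝ u v = rdeg H u := by
  have h := H.adjMatrix_mulVec_const_apply (α := ℝ) (a := 1) (v := u)
  simp only [Matrix.mulVec, dotProduct, Function.const, mul_one] at h
  exact h

theorem degIn_nonneg (S : Set V) (u : V) : 0 ≤ degIn H S u :=
  Finset.sum_nonneg fun v _ => mul_nonneg (adjMatrix_nonneg H u v) (chi_nonneg S v)

theorem degIn_compl (S : Set V) (u : V) : degIn H Sᶜ u = rdeg H u - degIn H S u := by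
  simp only [degIn, chi_compl, ← sum_adjMatrix, ← Finset.sum_sub_distrib]
  exact Finset.sum_congr rfl fun v _ => by ring

theorem degIn_le_rdeg (I : Set V) (u : V) : degIn H I u ≤ rdeg H u := by
  have h := degIn_compl H I u
  have h2 := degIn_nonneg H Iᶜ u
  linarith

/-- Double counting of the edges between `S` and `T`. -/
theorem wt_degIn_symm (S T : Set V) : wt (degIn H S) T = wt (degIn H T) S := by
  simp only [wt, degIn, Finset.mul_sum]
  rw [Finset.sum_comm]
  refine Finset.sum_congr rfl fun v _ => Finset.sum_congr rfl fun u _ => ?_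
  rw [adjMatrix_symm H u v]; ring

theorem wt_degIn_compl (S : Set V) : wt (degIn H Sᶜ) S = wt (rdeg H) S - wt (degIn H S) S := by
  simp only [wt, degIn_compl, ← Finset.sum_sub_distrib]
  exact Finset.sum_congr rfl fun v _ => by ring

variable {H}

theorem degIn_mono_graph {H' : SimpleGraph V} [DecidableRel H'.Adj] (h : H ≤ H') (S : Set V)
    (u : V) : degIn H S u ≤ degIn H' S u := by
  refine Finset.sum_le_sum fun v _ => mul_le_mul_of_nonneg_right ?_ (chi_nonneg S v)
  simp only [SimpleGraph.adjMatrix_apply]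
  split_ifs with h1 h2 <;> first | simp | exact absurd (h h1) h2

/-- The edge distribution of dense enough subgraphs of expanders: `D` is the maximum degree of the
expander, `θ` the error and `c` the edge expansion. -/
structure WellSpread (H : SimpleGraph V) [DecidableRel H.Adj] (D θ c : ℝ) : Prop where
  pos : 0 < D
  error_nonneg : 0 ≤ θ
  half_le_rdeg : ∀ u, D / 2 ≤ rdeg H u
  rdeg_le : ∀ u, rdeg H u ≤ D
  inner_le : ∀ S, wt (degIn H S) S ≤ (sz S / Fintype.card V + θ) * D * sz S
  sum_sq_le : ∀ S, ∑ u, degIn H S u ^ 2 ≤ 2 * (sz S / Fintype.card V + θ) * D ^ 2 * sz S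
  boundary_ge : ∀ S, c * D * min (sz S) (sz Sᶜ) ≤ wt (degIn H Sᶜ) S

theorem WellSpread.rdeg_pos {D θ c : ℝ} (hH : WellSpread H D θ c) (u : V) : 0 < rdeg H u := by
  have := hH.half_le_rdeg u
  have := hH.pos
  linarith

theorem WellSpread.vol_le {D θ c : ℝ} (hH : WellSpread H D θ c) (I : Set V) :
    wt (rdeg H) I ≤ D * sz I := by
  rw [← wt_const]; exact wt_mono hH.rdeg_le I

theorem WellSpread.le_vol {D θ c : ℝ} (hH : WellSpread H D θ c) (I : Set V) :
    D / 2 * sz I ≤ wt (rdeg H) I := by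
  rw [← wt_const]; exact wt_mono hH.half_le_rdeg I

/-- The expander mixing lemma. The indicator of `S` splits into a constant and a part orthogonal to
constants; the former contributes the density `|S|/n`, the latter at most `θ` by the spectral
estimate. The square sum uses `(a + b)² ≤ 2a² + 2b²`, with `θ² ≤ θ`. -/
theorem wt_degIn_le_of_spectral [Nonempty V] [DecidableEq V] (G : SimpleGraph V)
    [DecidableRel G.Adj] {θ : ℝ} (hθ : 0 ≤ θ)
    (h : (G.maxDegree : ℝ) ^ 2 - (G.minDegree : ℝ) ^ 2 + 2 * secondEigenvalue G ^ 2 ≤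
      (θ * G.maxDegree) ^ 2) (S : Set V) :
    wt (degIn G S) S ≤ (sz S / Fintype.card V + θ) * G.maxDegree * sz S ∧
    (θ ≤ 1 → ∑ u, degIn G S u ^ 2 ≤
      2 * (sz S / Fintype.card V + θ) * (G.maxDegree : ℝ) ^ 2 * sz S) := by
  set n : ℝ := ((Fintype.card V : ℕ) : ℝ) with hn
  set Δ : ℝ := ((G.maxDegree : ℕ) : ℝ) with hΔ
  have hn0 : 0 < n := by simpa [n] using Fintype.card_pos (α := V)
  have hΔ0 : 0 ≤ Δ := by positivity
  set x : V → ℝ := fun u => chi S u - sz S / n with hx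
  have hxsum : ∑ u, x u = 0 := by
    simp only [hx, Finset.sum_sub_distrib, Finset.sum_const, Finset.card_univ, nsmul_eq_mul]
    change sz S - n * (sz S / n) = 0
    field_simp; ring
  have hxsq : ∑ u, x u ^ 2 ≤ sz S := by
    have : ∀ u, x u ^ 2 = chi S u - 2 * (sz S / n) * chi S u + (sz S / n) ^ 2 := fun u => by
      simp only [hx, sub_sq, chi_sq]; ring
    simp only [this, Finset.sum_add_distrib, Finset.sum_sub_distrib, ← Finset.mul_sum,
      Finset.sum_const, Finset.card_univ, nsmul_eq_mul]
    change sz S - 2 * (sz S / n) * sz S + n * (sz S / n) ^ 2 ≤ sz S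
    have e : n * (sz S / n) ^ 2 = sz S / n * sz S := by field_simp
    have : 0 ≤ sz S / n * sz S := by have := sz_nonneg S; positivity
    rw [e]; linarith
  set z : V → ℝ := fun u => ∑ v, G.adjMatrix ℝ u v * x v with hz
  have hzsq : ∑ u, z u ^ 2 ≤ (θ * Δ) ^ 2 * sz S := by
    refine (sum_sq_adjMatrix_mulVec_le_of_sum_eq_zero G hxsum).trans ?_
    exact mul_le_mul h hxsq (Finset.sum_nonneg fun _ _ => sq_nonneg _) (sq_nonneg _)
  have hdecomp : ∀ u, degIn G S u = sz S / n * rdeg G u + z u := fun u => by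
    simp only [degIn, hz, hx, ← sum_adjMatrix, Finset.mul_sum, ← Finset.sum_add_distrib]
    exact Finset.sum_congr rfl fun v _ => by ring
  have hdeg : ∀ u, rdeg G u ≤ Δ := fun u => by
    simpa [rdeg, hΔ] using G.degree_le_maxDegree u
  have hdeg0 : ∀ u, 0 ≤ rdeg G u := fun u => by simp [rdeg]
  have hS0 := sz_nonneg S
  have hSn : sz S / n ≤ 1 := by
    rw [div_le_one hn0]
    have := sz_mono (Set.subset_univ S)
    rwa [sz_univ] at this
  constructor
  · have h1 : wt (degIn G S) S = sz S / n * wt (rdeg G) S + ∑ u, chi S u * z u := by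
      simp only [wt, hdecomp, Finset.mul_sum, ← Finset.sum_add_distrib]
      exact Finset.sum_congr rfl fun v _ => by ring
    have h2 : ∑ u, chi S u * z u ≤ θ * Δ * sz S := by
      refine abs_le_of_sq_le_sq' ?_ (by positivity) |>.2
      refine (Finset.sum_mul_sq_le_sq_mul_sq _ _ _).trans ?_
      simp only [chi_sq]
      calc sz S * ∑ u, z u ^ 2 ≤ sz S * ((θ * Δ) ^ 2 * sz S) := by gcongr
        _ = _ := by ring
    have h3 : wt (rdeg G) S ≤ Δ * sz S := by
      rw [← wt_const]; exact wt_mono hdeg S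
    calc wt (degIn G S) S ≤ sz S / n * (Δ * sz S) + θ * Δ * sz S := by rw [h1]; gcongr
      _ = _ := by ring
  · intro hθ1
    calc ∑ u, degIn G S u ^ 2 ≤ ∑ u, (2 * (sz S / n * Δ) ^ 2 + 2 * z u ^ 2) := by
          refine Finset.sum_le_sum fun u _ => ?_
          rw [hdecomp]
          have h1 : (sz S / n * rdeg G u) ^ 2 ≤ (sz S / n * Δ) ^ 2 := by
            have := hdeg0 u
            have := hdeg u
            gcongr
          nlinarith [sq_nonneg (sz S / n * rdeg G u - z u)]
      _ = 2 * (n * (sz S / n * Δ) ^ 2) + 2 * ∑ u, z u ^ 2 := by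
          simp only [Finset.sum_add_distrib, Finset.sum_const, Finset.card_univ, nsmul_eq_mul,
            ← Finset.mul_sum]
          ring
      _ ≤ 2 * (sz S / n * Δ ^ 2 * sz S) + 2 * (θ * Δ ^ 2 * sz S) := by
          refine add_le_add (mul_le_mul_of_nonneg_left (le_of_eq ?_) (by norm_num))
            (mul_le_mul_of_nonneg_left (hzsq.trans ?_) (by norm_num))
          · field_simp
          · have : θ ^ 2 ≤ θ := by nlinarith
            rw [mul_pow]
            gcongr
      _ = _ := by ring

/-- Upper bounds on inner edges pass to subgraphs. For the boundary of a set of at most half of the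
vertices, compare the kept degrees, about `(1/2 + ε) Δ`, with the inner degrees, on average at most
`(1/2 + θ) Δ`; for larger sets, pass to the complement. -/
theorem wellSpread_of_edgeDeletion [Nonempty V] [DecidableEq V] {G G' : SimpleGraph V}
    [DecidableRel G.Adj] [DecidableRel G'.Adj] {ε θ : ℝ} (hε : 0 < ε) (hε' : ε < 1 / 2)
    (hdel : IsEdgeDeletion G G' (1 / 2 + ε)) (hθ : 0 ≤ θ) (hθε : θ ≤ ε / 4)
    (hpos : 0 < G.maxDegree) (hratio : (1 - θ) * G.maxDegree ≤ (G.minDegree : ℝ))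
    (h : (G.maxDegree : ℝ) ^ 2 - (G.minDegree : ℝ) ^ 2 + 2 * secondEigenvalue G ^ 2 ≤
      (θ * G.maxDegree) ^ 2) :
    WellSpread G' G.maxDegree θ (ε / 2) := by
  set Δ : ℝ := ((G.maxDegree : ℕ) : ℝ) with hΔ
  set n : ℝ := ((Fintype.card V : ℕ) : ℝ) with hn
  have hn0 : 0 < n := by simpa [n] using Fintype.card_pos (α := V)
  have hΔ0 : 0 < Δ := by simpa [hΔ] using hpos
  have hlow : ∀ u, (1 / 2 + ε) * ((1 - θ) * Δ) ≤ rdeg G' u := fun u => by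
    refine le_trans ?_ (hdel.keeps u)
    have : (G.minDegree : ℝ) ≤ G.degree u := by exact_mod_cast G.minDegree_le_degree u
    gcongr
    linarith
  have hin : ∀ S, wt (degIn G' S) S ≤ (sz S / n + θ) * Δ * sz S := fun S =>
    (wt_mono (degIn_mono_graph hdel.le S) S).trans (wt_degIn_le_of_spectral G hθ h S).1
  have hbd : ∀ S, sz S ≤ n / 2 → ε / 2 * Δ * sz S ≤ wt (degIn G' Sᶜ) S := fun S hS => by
    rw [wt_degIn_compl]
    have h1 : (1 / 2 + ε) * ((1 - θ) * Δ) * sz S ≤ wt (rdeg G') S := by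
      rw [← wt_const]; exact wt_mono hlow S
    have h2 : wt (degIn G' S) S ≤ (1 / 2 + θ) * Δ * sz S := by
      refine (hin S).trans ?_
      have := sz_nonneg S
      have : sz S / n ≤ 1 / 2 := by rw [div_le_iff₀ hn0]; linarith
      gcongr
    have h3 : 0 ≤ Δ * sz S := mul_nonneg hΔ0.le (sz_nonneg S)
    -- The right side is `ε - θ (3/2 + ε)`, and `3/2 + ε < 2` while `θ ≤ ε/4`.
    have h4 : ε / 2 ≤ (1 / 2 + ε) * (1 - θ) - (1 / 2 + θ) := by nlinarith
    nlinarith [mul_le_mul_of_nonneg_right h4 h3]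
  refine ⟨hΔ0, hθ, fun u => le_trans ?_ (hlow u), fun u => ?_, hin, fun S => ?_, fun S => ?_⟩
  · have : 1 / 2 ≤ (1 / 2 + ε) * (1 - θ) := by nlinarith
    nlinarith
  · have h1 : G'.degree u ≤ G.degree u := SimpleGraph.degree_le_of_le hdel.le
    exact Nat.cast_le.2 (h1.trans (G.degree_le_maxDegree u))
  · refine le_trans (Finset.sum_le_sum fun u _ => ?_)
      ((wt_degIn_le_of_spectral G hθ h S).2 (by linarith))
    exact pow_le_pow_left₀ (degIn_nonneg G' S u) (degIn_mono_graph hdel.le S u) 2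
  · have hc : sz Sᶜ = n - sz S := sz_compl S
    rcases le_total (sz S) (n / 2) with hS | hS
    · refine le_trans ?_ (hbd S hS)
      gcongr
      exact min_le_left _ _
    · have h1 := hbd Sᶜ (by rw [hc]; linarith)
      rw [compl_compl, wt_degIn_symm] at h1
      refine le_trans ?_ h1
      gcongr
      exact min_le_right _ _

/-- Edge deletions of expander sequences are eventually well spread, with arbitrarily small
error. -/
theorem IsExpanderSequence.eventually_wellSpread {G G' : ∀ n : ℕ, SimpleGraph (Fin n)}
    [∀ n, DecidableRel (G n).Adj] [∀ n, DecidableRel (G' n).Adj] (hG : IsExpanderSequence G)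
    {ε θ : ℝ} (hε : 0 < ε) (hε' : ε < 1 / 2)
    (hG' : ∀ n, IsEdgeDeletion (G n) (G' n) (1 / 2 + ε)) (hθ : 0 < θ) (hθε : θ ≤ ε / 4) :
    ∀ᶠ n in atTop, WellSpread (G' n) (G n).maxDegree θ (ε / 2) := by
  -- With `δ ≥ (1 - θ²/4) Δ` and `λ ≤ θ Δ / 2`, the degree defect `Δ² - δ²` and the term `2 λ²` are
  -- each at most `θ² Δ² / 2`.
  have hr : 1 < 1 / (1 - θ ^ 2 / 4) := by
    rw [lt_div_iff₀] <;> nlinarith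
  filter_upwards [hG.degree_ratio.eventually (gt_mem_nhds hr),
    hG.degree_ratio.eventually (lt_mem_nhds (show (1 / 2 : ℝ) < 1 by norm_num)),
    hG.eigenvalue_small.bound (show 0 < θ / 2 by positivity), eventually_ge_atTop 1]
    with n h1 h2 h3 h4
  have : Nonempty (Fin n) := ⟨⟨0, h4⟩⟩
  set Δ : ℝ := (((G n).maxDegree : ℕ) : ℝ) with hΔ
  set δ : ℝ := (((G n).minDegree : ℕ) : ℝ) with hδ
  -- As `Δ / 0 = 0`, a ratio above `1/2` excludes vanishing degrees.
  have hδ0 : 0 < δ := by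
    rcases (show 0 ≤ δ by positivity).eq_or_lt with h | h
    · rw [← h, div_zero] at h2; linarith
    · exact h
  have hΔ0 : 0 < Δ := by
    rcases (show 0 ≤ Δ by positivity).eq_or_lt with h | h
    · rw [← h, zero_div] at h2; linarith
    · exact h
  have hden : 0 < 1 - θ ^ 2 / 4 := by nlinarith
  have hδΔ : (1 - θ ^ 2 / 4) * Δ ≤ δ := by
    rw [div_lt_div_iff₀ hδ0 hden] at h1
    linarith
  refine wellSpread_of_edgeDeletion hε hε' (hG' n) hθ.le hθε (by simpa [hΔ] using hΔ0) ?_ ?_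
  · refine le_trans ?_ hδΔ
    gcongr
    nlinarith
  · rw [Real.norm_eq_abs, Real.norm_eq_abs, abs_of_pos hΔ0] at h3
    have h5 : secondEigenvalue (G n) ^ 2 ≤ (θ / 2 * Δ) ^ 2 := by
      rw [← sq_abs]; gcongr
    have h6 : ((1 - θ ^ 2 / 4) * Δ) ^ 2 ≤ δ ^ 2 := by gcongr
    nlinarith [sq_nonneg (θ ^ 2 * Δ)]

end Weights

/-! ### Moments of one round -/

section Moments

/-- The indicator of a successful transmission. -/
def ok (b : Bool) : ℝ := if b = true then 1 else 0

theorem ok_nonneg (b : Bool) : 0 ≤ ok b := by cases b <;> simp [ok]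

theorem ok_le_one (b : Bool) : ok b ≤ 1 := by cases b <;> simp [ok]

theorem ok_sq (b : Bool) : ok b ^ 2 = ok b := by cases b <;> simp [ok]

variable {V : Type*} [Fintype V] [MeasurableSpace V]

/-- The law of the call of a single vertex. -/
def callMeasure (H : SimpleGraph V) [DecidableRel H.Adj] (q : unitInterval) (u : V) :
    Measure (V × Bool) :=
  (calledVertex H u).toMeasure.prod (bernoulliMeasure true false q)

instance (H : SimpleGraph V) [DecidableRel H.Adj] (q : unitInterval) (u : V) :
    IsProbabilityMeasure (callMeasure H q u) := by
  unfold callMeasure; infer_instance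

theorem roundMeasure_eq (H : SimpleGraph V) [DecidableRel H.Adj] (q : unitInterval) :
    roundMeasure H q = Measure.pi (callMeasure H q) := rfl

variable [MeasurableSingletonClass V] (H : SimpleGraph V) [DecidableRel H.Adj] (q : unitInterval)

theorem integral_callMeasure {u : V} (hu : 0 < rdeg H u) (f : V → ℝ) :
    ∫ x, f x.1 * ok x.2 ∂(callMeasure H q u) =
      q * ((∑ w, H.adjMatrix ℝ u w * f w) / rdeg H u) := by
  classical
  have hne : (H.neighborFinset u).Nonempty := by
    rw [← Finset.card_pos, SimpleGraph.card_neighborFinset_eq_degree]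
    exact Nat.cast_pos.1 hu
  rw [callMeasure, integral_prod_mul, integral_bernoulliMeasure, PMF.integral_eq_sum]
  simp only [ok, if_true, Bool.false_eq_true, if_false, smul_eq_mul, mul_one, mul_zero, add_zero]
  rw [mul_comm, Finset.sum_div]
  congr 1
  refine Finset.sum_congr rfl fun w _ => ?_
  simp only [calledVertex, hne, dif_pos, PMF.uniformOfFinset_apply, SimpleGraph.mem_neighborFinset,
    SimpleGraph.adjMatrix_apply, rdeg, SimpleGraph.card_neighborFinset_eq_degree]
  split_ifs with h
  · simp [div_eq_mul_inv, mul_comm]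
  · simp

theorem integral_round_sum (g : V → V × Bool → ℝ) :
    ∫ ρ, ∑ v, g v (ρ v) ∂(roundMeasure H q) = ∑ v, ∫ x, g v x ∂(callMeasure H q v) := by
  rw [integral_finsetSum _ fun v _ => integrable_round _ _]
  exact Finset.sum_congr rfl fun v _ => integral_comp_eval (by fun_prop)

/-- Different vertices call independently, so variances add, and each is at most the second moment.
-/
theorem integral_round_sum_sub_sq_le (g : V → V × Bool → ℝ) :
    ∫ ρ, (∑ v, g v (ρ v) - ∑ v, ∫ x, g v x ∂(callMeasure H q v)) ^ 2 ∂(roundMeasure H q) ≤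
      ∑ v, ∫ x, g v x ^ 2 ∂(callMeasure H q v) := by
  have h := variance_sum_pi (μ := callMeasure H q) (X := g) fun v => MemLp.of_discrete
  rw [variance_eq_integral (by fun_prop)] at h
  simp only [Finset.sum_apply] at h
  rw [← roundMeasure_eq, integral_round_sum] at h
  rw [h]
  refine Finset.sum_le_sum fun v _ => ?_
  have h2 := variance_le_expectation_sq (μ := callMeasure H q v) (X := g v) (by fun_prop)
  simpa using h2

theorem integral_round_sum_sq_le (g : V → V × Bool → ℝ) :
    ∫ ρ, (∑ v, g v (ρ v)) ^ 2 ∂(roundMeasure H q) ≤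
      (∑ v, ∫ x, g v x ∂(callMeasure H q v)) ^ 2 + ∑ v, ∫ x, g v x ^ 2 ∂(callMeasure H q v) := by
  have h := integral_round_sum_sub_sq_le H q g
  set M := ∑ v, ∫ x, g v x ∂(callMeasure H q v) with hM
  have h2 : ∫ ρ, (∑ v, g v (ρ v) - M) ^ 2 ∂(roundMeasure H q) =
      ∫ ρ, (∑ v, g v (ρ v)) ^ 2 ∂(roundMeasure H q) - M ^ 2 := by
    have e : ∀ ρ : Round V, (∑ v, g v (ρ v) - M) ^ 2 =
        (∑ v, g v (ρ v)) ^ 2 - 2 * M * (∑ v, g v (ρ v)) + M ^ 2 := fun ρ => by ring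
    simp only [e]
    rw [integral_add (integrable_round _ _) (integrable_round _ _),
      integral_sub (integrable_round _ _) (integrable_round _ _), integral_const_mul,
      integral_round_sum, ← hM]
    simp
    ring
  linarith

/-- A lower bound `S - C` for the gain `Y` in terms of a concentrated `S` and a small `C` bounds the
mean of the reciprocal. -/
theorem integral_inv_le (μ : Measure (Round V)) [IsProbabilityMeasure μ] {X M v : ℝ} (hX : 0 < X)
    {Y S C : Round V → ℝ} (hY : ∀ ρ, 0 ≤ Y ρ) (hS : ∀ ρ, 0 ≤ S ρ) (hC : ∀ ρ, 0 ≤ C ρ)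
    (h : ∀ ρ, S ρ ≤ Y ρ + C ρ) (hM : ∫ ρ, S ρ ∂μ = M) (hv : ∫ ρ, (S ρ - M) ^ 2 ∂μ ≤ v) :
    ∫ ρ, 1 / (X + Y ρ) ∂μ ≤ 1 / (X + M) + v / X ^ 3 + (∫ ρ, C ρ ∂μ) / X ^ 2 := by
  have hM0 : 0 ≤ M := hM ▸ integral_nonneg hS
  -- First `Y` is replaced by `S` at cost `C / X²`; then `1 / (X + S)` is expanded at `S = M` with
  -- exact remainder. The linear term has mean zero.
  have hpt : ∀ ρ, 1 / (X + Y ρ) ≤ 1 / (X + M) - (S ρ - M) * (1 / (X + M) ^ 2) +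
      (S ρ - M) ^ 2 * (1 / X ^ 3) + C ρ * (1 / X ^ 2) := by
    intro ρ
    have hy := hY ρ
    have hs := hS ρ
    have hc := hC ρ
    have h1 : 1 / (X + Y ρ) ≤ 1 / (X + S ρ) + C ρ * (1 / X ^ 2) := by
      have e : 1 / (X + Y ρ) = 1 / (X + Y ρ + C ρ) + C ρ * (1 / ((X + Y ρ) * (X + Y ρ + C ρ))) := by
        field_simp
      rw [e]
      have h3 : 1 / (X + Y ρ + C ρ) ≤ 1 / (X + S ρ) :=
        one_div_le_one_div_of_le (by linarith) (by linarith [h ρ])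
      have h4 : 1 / ((X + Y ρ) * (X + Y ρ + C ρ)) ≤ 1 / X ^ 2 := by
        refine one_div_le_one_div_of_le (by positivity) ?_
        rw [sq]
        gcongr <;> linarith
      exact add_le_add h3 (mul_le_mul_of_nonneg_left h4 hc)
    have h2 : 1 / (X + S ρ) ≤ 1 / (X + M) - (S ρ - M) * (1 / (X + M) ^ 2) +
        (S ρ - M) ^ 2 * (1 / X ^ 3) := by
      have e : 1 / (X + S ρ) = 1 / (X + M) - (S ρ - M) * (1 / (X + M) ^ 2) +
          (S ρ - M) ^ 2 * (1 / ((X + M) ^ 2 * (X + S ρ))) := by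
        field_simp
        ring
      rw [e]
      gcongr
      calc X ^ 3 = X ^ 2 * X := by ring
        _ ≤ (X + M) ^ 2 * (X + S ρ) := by gcongr <;> linarith
    linarith
  calc ∫ ρ, 1 / (X + Y ρ) ∂μ
      ≤ ∫ ρ, (1 / (X + M) - (S ρ - M) * (1 / (X + M) ^ 2) +
        (S ρ - M) ^ 2 * (1 / X ^ 3) + C ρ * (1 / X ^ 2)) ∂μ :=
        integral_mono (integrable_round _ _) (integrable_round _ _) hpt
    _ = 1 / (X + M) + (∫ ρ, (S ρ - M) ^ 2 ∂μ) * (1 / X ^ 3) + (∫ ρ, C ρ ∂μ) * (1 / X ^ 2) := by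
        rw [integral_add (integrable_round _ _) (integrable_round _ _),
          integral_add (integrable_round _ _) (integrable_round _ _),
          integral_sub (integrable_round _ _) (integrable_round _ _),
          integral_mul_const, integral_mul_const, integral_mul_const,
          integral_sub (integrable_round _ _) (integrable_round _ _), hM]
        simp
    _ ≤ _ := by
        rw [div_eq_mul_one_div v, div_eq_mul_one_div (∫ ρ, C ρ ∂μ)]
        gcongr

end Moments

/-! ### One round of pull -/

section Pull

theorem subset_pull {V : Type*} (ρ : Round V) (I : Set V) : I ⊆ pull ρ I :=
  Set.subset_union_left

theorem chi_pull {V : Type*} (ρ : Round V) (I : Set V) (u : V) :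
    chi (pull ρ I) u = chi I u + chi Iᶜ u * (chi I (ρ u).1 * ok (ρ u).2) := by
  by_cases h1 : u ∈ I <;> by_cases h2 : (ρ u).1 ∈ I <;> by_cases h3 : (ρ u).2 = true <;>
    simp [chi, pull, ok, h1, h2, h3]

variable {V : Type*} [Fintype V]

theorem wt_pull (s : V → ℝ) (ρ : Round V) (I : Set V) :
    wt s (pull ρ I) = wt s I + ∑ u, chi Iᶜ u * s u * (chi I (ρ u).1 * ok (ρ u).2) := by
  simp only [wt, chi_pull, ← Finset.sum_add_distrib]
  exact Finset.sum_congr rfl fun u _ => by ring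

variable [MeasurableSpace V] [MeasurableSingletonClass V]
  (H : SimpleGraph V) [DecidableRel H.Adj] (q : unitInterval)

theorem integral_pull_call {u : V} (hu : 0 < rdeg H u) (c : ℝ) (I : Set V) :
    ∫ x, c * (chi I x.1 * ok x.2) ∂(callMeasure H q u) = c * (q * (degIn H I u / rdeg H u)) := by
  rw [integral_const_mul, integral_callMeasure H q hu]
  rfl

theorem integral_wt_pull (hdeg : ∀ u, 0 < rdeg H u) (s : V → ℝ) (I : Set V) :
    ∫ ρ, wt s (pull ρ I) ∂(roundMeasure H q) =
      wt s I + q * ∑ u, chi Iᶜ u * s u * (degIn H I u / rdeg H u) := by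
  simp only [wt_pull]
  rw [integral_add (integrable_round _ _) (integrable_round _ _),
    integral_round_sum H q (fun u x => chi Iᶜ u * s u * (chi I x.1 * ok x.2))]
  simp only [integral_pull_call H q (hdeg _), Finset.mul_sum, integral_const, probReal_univ,
    one_smul]
  congr 1
  exact Finset.sum_congr rfl fun u _ => by ring

/-- The weight `d(u)` cancels the probability `1/d(u)` of calling a given neighbour, so each
boundary edge contributes `q`. -/
theorem integral_vol_pull (hdeg : ∀ u, 0 < rdeg H u) (I : Set V) :
    ∫ ρ, wt (rdeg H) (pull ρ I) ∂(roundMeasure H q) =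
      wt (rdeg H) I + q * wt (degIn H Iᶜ) I := by
  rw [integral_wt_pull H q hdeg, wt_degIn_symm]
  congr 2
  refine Finset.sum_congr rfl fun u _ => ?_
  rw [mul_assoc, mul_div_cancel₀ _ (hdeg u).ne']

/-- The volume of the informed set grows at most by the factor `1 + q` in expectation. -/
theorem transition_pull_vol_le (hdeg : ∀ u, 0 < rdeg H u) (I : Set V) :
    transition pull (roundMeasure H q) (wt (rdeg H)) I ≤ (1 + q) * wt (rdeg H) I := by
  rw [transition, integral_vol_pull H q hdeg, wt_degIn_compl, add_mul, one_mul]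
  have : 0 ≤ wt (degIn H I) I := wt_nonneg (degIn_nonneg H I) I
  have hq := q.2.1
  gcongr
  linarith

/-- The survival weight: each uninformed vertex contributes a factor `1 - a`. -/
def survival (a : ℝ) (I : Set V) : ℝ := ∏ u, (1 - a * chi Iᶜ u)

/-- Calls are independent, so the mean of the product factorises. An uninformed vertex is informed
with probability at most `q`, which turns its factor `1 - a` into at most `1 - a (1 - q)`. -/
theorem transition_pull_survival_le (hdeg : ∀ u, 0 < rdeg H u) {a : ℝ} (ha : 0 ≤ a) (ha1 : a ≤ 1)
    (I : Set V) :
    transition pull (roundMeasure H q) (survival a) I ≤ survival (a * (1 - q)) I := by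
  have e : ∀ ρ : Round V, survival a (pull ρ I) =
      ∏ u, ((1 - a * chi Iᶜ u) + a * chi Iᶜ u * (chi I (ρ u).1 * ok (ρ u).2)) := fun ρ => by
    refine Finset.prod_congr rfl fun u _ => ?_
    rw [chi_compl, chi_pull, chi_compl]; ring
  have hq0 := q.2.1
  have hq1 := q.2.2
  simp only [transition, e]
  rw [roundMeasure_eq, integral_fintype_prod_eq_prod
    (fun u (x : V × Bool) => (1 - a * chi Iᶜ u) + a * chi Iᶜ u * (chi I x.1 * ok x.2))]
  refine Finset.prod_le_prod (fun u _ => integral_nonneg fun x => ?_) fun u _ => ?_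
  · have h1 := chi_nonneg Iᶜ u
    have h2 := chi_le_one Iᶜ u
    have h3 : 0 ≤ a * chi Iᶜ u * (chi I x.1 * ok x.2) :=
      mul_nonneg (mul_nonneg ha h1) (mul_nonneg (chi_nonneg _ _) (ok_nonneg _))
    have h4 : a * chi Iᶜ u ≤ 1 := mul_le_one₀ ha1 h1 h2
    change 0 ≤ (1 - a * chi Iᶜ u) + a * chi Iᶜ u * (chi I x.1 * ok x.2)
    linarith
  · rw [integral_add Integrable.of_finite Integrable.of_finite, integral_pull_call H q (hdeg u)]
    have h1 : degIn H I u / rdeg H u ≤ 1 := (div_le_one (hdeg u)).2 (degIn_le_rdeg H I u)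
    have h2 : 0 ≤ a * chi Iᶜ u := mul_nonneg ha (chi_nonneg _ _)
    have h3 : (q : ℝ) * (degIn H I u / rdeg H u) ≤ q := mul_le_of_le_one_right hq0 h1
    simp only [integral_const, probReal_univ, one_smul]
    nlinarith [mul_le_mul_of_nonneg_left h3 h2]

/-- Vertices that never receive a successful transmission stay uninformed. -/
theorem transition_iterate_pull_univ_le (hdeg : ∀ u, 0 < rdeg H u) (t : ℕ) (I : Set V) :
    (transition pull (roundMeasure H q))^[t] (ind {Set.univ}) I ≤
      Real.exp (-((1 - q) ^ t * sz Iᶜ)) := by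
  have hq0 := q.2.1
  have hq1 := q.2.2
  have hpow : ∀ t : ℕ, (1 - q : ℝ) ^ t ≤ 1 := fun t => pow_le_one₀ (by linarith) (by linarith)
  have hpow0 : ∀ t : ℕ, 0 ≤ (1 - q : ℝ) ^ t := fun t => pow_nonneg (by linarith) t
  -- The induction starts from `survival 1`, which is the indicator of the full set.
  have key : ∀ (t : ℕ) (I : Set V), (transition pull (roundMeasure H q))^[t] (ind {Set.univ}) I ≤
      survival ((1 - q) ^ t) I := by
    intro t
    induction t with
    | zero =>
      intro I
      by_cases h : I = Set.univ
      · subst h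
        simp [ind, survival, chi]
      · have : 0 ≤ survival 1 I := Finset.prod_nonneg fun u _ => by
          have := chi_le_one Iᶜ u; linarith
        simpa [ind, h] using this
    | succ t ih =>
      intro I
      rw [Function.iterate_succ_apply', pow_succ]
      exact (transition_mono _ _ ih I).trans
        (transition_pull_survival_le H q hdeg (hpow0 t) (hpow t) I)
  refine (key t I).trans ?_
  rw [survival, sz, Finset.mul_sum, ← Finset.sum_neg_distrib, Real.exp_sum]
  refine Finset.prod_le_prod (fun u _ => ?_) fun u _ => ?_
  · have := mul_le_one₀ (hpow t) (chi_nonneg Iᶜ u) (chi_le_one Iᶜ u)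
    linarith
  · have := Real.add_one_le_exp (-((1 - q : ℝ) ^ t * chi Iᶜ u))
    linarith

variable {H}
variable {D θ c : ℝ}

/-- The mean of the reciprocal volume after a round of pull, with a thinning parameter `τ`. -/
theorem WellSpread.transition_pull_inv_vol_le (hH : WellSpread H D θ c) {τ : ℝ} (hτ : 0 ≤ τ)
    (hτ1 : τ ≤ 1) {I : Set V} (hI : 0 < sz I) :
    transition pull (roundMeasure H q) (fun J => 1 / wt (rdeg H) J) I ≤
      (1 / (1 + τ * (q * wt (degIn H Iᶜ) I / wt (rdeg H) I)) +
        τ ^ 2 * (2 / sz I) * (q * wt (degIn H Iᶜ) I / wt (rdeg H) I)) * (1 / wt (rdeg H) I) := by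
  set X := wt (rdeg H) I with hX
  set E := q * wt (degIn H Iᶜ) I with hE
  have hD := hH.pos
  have hX0 : 0 < X := lt_of_lt_of_le (by positivity) (hH.le_vol I)
  have hE0 : 0 ≤ E := mul_nonneg q.2.1 (wt_nonneg (degIn_nonneg H _) I)
  set g : V → V × Bool → ℝ := fun u x => chi Iᶜ u * rdeg H u * (chi I x.1 * ok x.2) with hg
  have hg0 : ∀ u x, 0 ≤ g u x := fun u x => mul_nonneg
    (mul_nonneg (chi_nonneg _ _) (hH.rdeg_pos u).le) (mul_nonneg (chi_nonneg _ _) (ok_nonneg _))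
  have hgD : ∀ u x, g u x ≤ D := fun u x => by
    have h1 : chi Iᶜ u * rdeg H u ≤ D :=
      (mul_le_of_le_one_left (hH.rdeg_pos u).le (chi_le_one _ _)).trans (hH.rdeg_le u)
    have h2 : chi I x.1 * ok x.2 ≤ 1 := mul_le_one₀ (chi_le_one _ _) (ok_nonneg _) (ok_le_one _)
    exact (mul_le_of_le_one_right (mul_nonneg (chi_nonneg _ _) (hH.rdeg_pos u).le) h2).trans h1
  have hsum : ∑ u, ∫ x, g u x ∂(callMeasure H q u) = E := by
    have h1 := integral_vol_pull H q hH.rdeg_pos I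
    simp only [wt_pull] at h1
    rw [integral_add (integrable_round _ _) (integrable_round _ _)] at h1
    rw [← integral_round_sum H q g]
    simpa using h1
  have hvar : ∑ u, ∫ x, (τ * g u x) ^ 2 ∂(callMeasure H q u) ≤ τ ^ 2 * (D * E) := by
    rw [← hsum, Finset.mul_sum, Finset.mul_sum]
    refine Finset.sum_le_sum fun u _ => ?_
    rw [← integral_const_mul, ← integral_const_mul]
    refine integral_mono Integrable.of_finite Integrable.of_finite fun x => ?_
    have := mul_le_mul_of_nonneg_right (hgD u x) (hg0 u x)
    change (τ * g u x) ^ 2 ≤ τ ^ 2 * (D * g u x)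
    rw [mul_pow]
    gcongr
    linarith
  have hτsum : ∑ u, ∫ x, τ * g u x ∂(callMeasure H q u) = τ * E := by
    simp only [integral_const_mul, ← Finset.mul_sum, hsum]
  -- Only the fraction `τ` of the gain is used, which scales the mean by `τ` and the variance by
  -- `τ²`.
  have hmain := integral_inv_le (roundMeasure H q) (X := X) (M := τ * E) (v := τ ^ 2 * (D * E))
    hX0 (Y := fun ρ => ∑ u, g u (ρ u)) (S := fun ρ => ∑ u, τ * g u (ρ u)) (C := fun _ => 0)
    (fun ρ => Finset.sum_nonneg fun u _ => hg0 u _)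
    (fun ρ => Finset.sum_nonneg fun u _ => mul_nonneg hτ (hg0 u _)) (fun _ => le_rfl)
    (fun ρ => by
      rw [add_zero]
      exact Finset.sum_le_sum fun u _ => mul_le_of_le_one_left (hg0 u _) hτ1)
    (by rw [integral_round_sum H q fun u x => τ * g u x, hτsum])
    (by
      refine le_trans ?_ hvar
      rw [← hτsum]
      exact integral_round_sum_sub_sq_le H q fun u x => τ * g u x)
  simp only [transition, wt_pull]
  refine hmain.trans ?_
  simp only [integral_zero, zero_div, add_zero]
  rw [add_mul]
  have e1 : 1 / (X + τ * E) = 1 / (1 + τ * (E / X)) * (1 / X) := by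
    field_simp
  rw [e1]
  gcongr
  have h2 : D ≤ 2 / sz I * X := by
    rw [div_mul_eq_mul_div, le_div_iff₀ hI]
    linarith [hH.le_vol I]
  calc τ ^ 2 * (D * E) / X ^ 3 ≤ τ ^ 2 * ((2 / sz I * X) * E) / X ^ 3 := by gcongr
    _ = _ := by field_simp

/-- From every set of at most half of the vertices the volume grows by a constant factor. -/
theorem WellSpread.transition_pull_inv_vol_le_of_le_half (hH : WellSpread H D θ c) (hc : 0 ≤ c)
    {I : Set V} (hI : I.Nonempty) (hI2 : sz I ≤ Fintype.card V / 2) :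
    transition pull (roundMeasure H q) (fun J => 1 / wt (rdeg H) J) I ≤
      (1 - q * c / 16) * (1 / wt (rdeg H) I) := by
  have h1 := one_le_sz hI
  have hD := hH.pos
  have hX0 : 0 < wt (rdeg H) I := lt_of_lt_of_le (by positivity) (hH.le_vol I)
  -- For tiny sets the variance is not negligible; a small `τ` makes the linear term win. Here the
  -- main term saves `3m/32` and the variance costs at most `m/32`, leaving `m/16`.
  refine (hH.transition_pull_inv_vol_le q (τ := 1 / 8) (by norm_num) (by norm_num)
    (by linarith)).trans ?_
  set m := q * wt (degIn H Iᶜ) I / wt (rdeg H) I with hm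
  have hq0 := q.2.1
  have hq1 := q.2.2
  have hmlow : q * c ≤ m := by
    rw [hm, le_div_iff₀ hX0, mul_assoc]
    gcongr
    have h2 := hH.boundary_ge I
    rw [min_eq_left (by rw [sz_compl]; linarith)] at h2
    have h3 := mul_le_mul_of_nonneg_left (hH.vol_le I) hc
    linarith
  have hm0 : 0 ≤ m := le_trans (mul_nonneg hq0 hc) hmlow
  have hm1 : m ≤ 1 := by
    rw [hm, div_le_one hX0, wt_degIn_compl]
    have h4 : 0 ≤ wt (degIn H I) I := wt_nonneg (degIn_nonneg H I) I
    nlinarith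
  have h5 : 2 / sz I ≤ 2 := by rw [div_le_iff₀ (by linarith)]; linarith
  gcongr
  have h6 : 1 / (1 + 1 / 8 * m) ≤ 1 - 3 / 32 * m := by
    rw [div_le_iff₀ (by linarith)]; nlinarith
  have h7 : (1 / 8 : ℝ) ^ 2 * (2 / sz I) * m ≤ 1 / 32 * m := by
    have := mul_le_mul_of_nonneg_right h5 hm0
    nlinarith
  linarith

/-- The volume of small sets, that are not too small, grows by a factor close to `1 + q`. -/
theorem WellSpread.transition_pull_inv_vol_le_of_small (hH : WellSpread H D θ c) {K κ : ℝ}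
    (hK : 0 < K) {I : Set V} (hI : K ≤ sz I) (hI2 : sz I ≤ κ * Fintype.card V)
    (hκ : 2 * (κ + θ) ≤ 1) :
    transition pull (roundMeasure H q) (fun J => 1 / wt (rdeg H) J) I ≤
      (1 / (1 + q * (1 - 2 * (κ + θ))) + 2 / K) * (1 / wt (rdeg H) I) := by
  have hD := hH.pos
  have hI0 : 0 < sz I := by linarith
  have hX0 : 0 < wt (rdeg H) I := lt_of_lt_of_le (by positivity) (hH.le_vol I)
  refine (hH.transition_pull_inv_vol_le q (τ := 1) (by norm_num) le_rfl hI0).trans ?_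
  set m := q * wt (degIn H Iᶜ) I / wt (rdeg H) I with hm
  have hq0 := q.2.1
  have hq1 := q.2.2
  have hn0 : (0 : ℝ) < Fintype.card V := by
    have := sz_mono (Set.subset_univ I)
    rw [sz_univ] at this
    linarith
  have hmlow : q * (1 - 2 * (κ + θ)) ≤ m := by
    rw [hm, le_div_iff₀ hX0, mul_assoc]
    gcongr
    have h2 := hH.inner_le I
    have h3 : sz I / Fintype.card V ≤ κ := by rwa [div_le_iff₀ hn0]
    have h4 : wt (degIn H I) I ≤ (κ + θ) * D * sz I := h2.trans (by gcongr)
    have hκθ : 0 ≤ κ + θ := add_nonneg (le_trans (by positivity) h3) hH.error_nonneg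
    have h5 := mul_le_mul_of_nonneg_left (hH.le_vol I) hκθ
    rw [wt_degIn_compl]
    linarith
  have hm1 : m ≤ 1 := by
    rw [hm, div_le_one hX0, wt_degIn_compl]
    have h4 : 0 ≤ wt (degIn H I) I := wt_nonneg (degIn_nonneg H I) I
    nlinarith
  have hp : 0 ≤ (q : ℝ) * (1 - 2 * (κ + θ)) := mul_nonneg hq0 (by linarith)
  rw [one_mul, one_pow, one_mul]
  gcongr
  calc 2 / sz I * m ≤ 2 / sz I * 1 := by gcongr
    _ ≤ 2 / K := by rw [mul_one]; gcongr

/-- Once a constant fraction is informed, the uninformed volume decreases by a constant factor. -/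
theorem WellSpread.transition_pull_vol_compl_le (hH : WellSpread H D θ c) (hc : 0 ≤ c) {κ : ℝ}
    (hκ0 : 0 ≤ κ) (hκ1 : κ ≤ 1) {I : Set V} (hI : κ * Fintype.card V ≤ sz I) :
    transition pull (roundMeasure H q) (fun J => wt (rdeg H) Jᶜ) I ≤
      (1 - q * c * κ) * wt (rdeg H) Iᶜ := by
  have h0 : ∀ J, wt (rdeg H) Jᶜ = ∑ u, rdeg H u - wt (rdeg H) J := fun J => by
    linarith [wt_add_compl (rdeg H) J]
  have h1 : transition pull (roundMeasure H q) (fun J => wt (rdeg H) Jᶜ) I =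
      wt (rdeg H) Iᶜ - q * wt (degIn H Iᶜ) I := by
    simp only [transition, h0]
    rw [integral_sub (integrable_round _ _) (integrable_round _ _),
      integral_vol_pull H q hH.rdeg_pos]
    simp
    ring
  have hU := sz_nonneg Iᶜ
  -- One bound for both halves of the range, so that the edge expansion applies without cases.
  have hmin : κ * sz Iᶜ ≤ min (sz I) (sz Iᶜ) := by
    refine le_min (le_trans ?_ hI) (mul_le_of_le_one_left hU hκ1)
    gcongr
    rw [sz_compl]
    linarith [sz_nonneg I]
  have h2 : c * κ * wt (rdeg H) Iᶜ ≤ wt (degIn H Iᶜ) I := by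
    refine le_trans ?_ (hH.boundary_ge I)
    calc c * κ * wt (rdeg H) Iᶜ ≤ c * κ * (D * sz Iᶜ) := by
          gcongr; exact hH.vol_le _
      _ = c * D * (κ * sz Iᶜ) := by ring
      _ ≤ _ := by
          have := hH.pos
          gcongr
  have h3 := mul_le_mul_of_nonneg_left h2 q.2.1
  rw [h1]
  linarith

/-- Once few vertices are uninformed, their number decreases by a factor close to `1 - q`. -/
theorem WellSpread.transition_pull_sz_compl_le (hH : WellSpread H D θ c) {κ : ℝ} {I : Set V}
    (hI : sz Iᶜ ≤ κ * Fintype.card V) :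
    transition pull (roundMeasure H q) (fun J => sz Jᶜ) I ≤
      (1 - q * (1 - 2 * (κ + θ))) * sz Iᶜ := by
  rcases isEmpty_or_nonempty V with hV | hV
  · simp [transition, sz]
  have hn0 : (0 : ℝ) < Fintype.card V := by simpa using Fintype.card_pos (α := V)
  have hD := hH.pos
  have h0 : ∀ J : Set V, sz Jᶜ = Fintype.card V - wt (fun _ => 1) J := fun J => by
    rw [sz_compl, wt_const, one_mul]
  have h1 : transition pull (roundMeasure H q) (fun J => sz Jᶜ) I =
      sz Iᶜ - q * ∑ u, chi Iᶜ u * (degIn H I u / rdeg H u) := by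
    simp only [transition, h0]
    rw [integral_sub (integrable_round _ _) (integrable_round _ _),
      integral_wt_pull H q hH.rdeg_pos]
    simp
    ring
  -- A call misses `I` only along an edge inside the uninformed set, and such edges are few because
  -- that set is small.
  have h2 : ∑ u, chi Iᶜ u * (degIn H I u / rdeg H u) ≥ sz Iᶜ - 2 / D * wt (degIn H Iᶜ) Iᶜ := by
    rw [sz, wt, Finset.mul_sum, ← Finset.sum_sub_distrib]
    refine Finset.sum_le_sum fun u _ => ?_
    have h3 : degIn H I u / rdeg H u = 1 - degIn H Iᶜ u / rdeg H u := by
      rw [degIn_compl, sub_div, div_self (hH.rdeg_pos u).ne']; ring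
    have h4 : degIn H Iᶜ u / rdeg H u ≤ 2 / D * degIn H Iᶜ u := by
      rw [div_mul_eq_mul_div, div_le_div_iff₀ (hH.rdeg_pos u) hD]
      nlinarith [hH.half_le_rdeg u, degIn_nonneg H Iᶜ u]
    rw [h3]
    nlinarith [mul_le_mul_of_nonneg_left h4 (chi_nonneg Iᶜ u)]
  have h5 : wt (degIn H Iᶜ) Iᶜ ≤ (κ + θ) * D * sz Iᶜ := by
    refine (hH.inner_le Iᶜ).trans ?_
    have := sz_nonneg Iᶜ
    gcongr
    rwa [div_le_iff₀ hn0]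
  have h6 : 2 / D * wt (degIn H Iᶜ) Iᶜ ≤ 2 * (κ + θ) * sz Iᶜ := by
    calc 2 / D * wt (degIn H Iᶜ) Iᶜ ≤ 2 / D * ((κ + θ) * D * sz Iᶜ) := by gcongr
      _ = _ := by field_simp
  have hq0 := q.2.1
  rw [h1]
  have h7 : (1 - 2 * (κ + θ)) * sz Iᶜ ≤ ∑ u, chi Iᶜ u * (degIn H I u / rdeg H u) := by linarith
  nlinarith [mul_le_mul_of_nonneg_left h7 hq0]

end Pull

/-! ### One round of push&pull -/

section PushPull

theorem pull_subset_pushPull {V : Type*} (ρ : Round V) (I : Set V) : pull ρ I ⊆ pushPull ρ I :=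
  Set.subset_union_left

variable {V : Type*} [DecidableEq V]

/-- The indicator that the call `x` of `v` informs the uninformed vertex `u`. -/
def hit (I : Set V) (u v : V) (x : V × Bool) : ℝ :=
  chi Iᶜ u * ((if v = u then chi I x.1 else 0) + chi I v * (if x.1 = u then 1 else 0)) * ok x.2

theorem hit_nonneg (I : Set V) (u v : V) (x : V × Bool) : 0 ≤ hit I u v x := by
  have h1 := chi_nonneg Iᶜ u
  have h2 := chi_nonneg I v
  have h3 := chi_nonneg I x.1
  have h4 := ok_nonneg x.2
  unfold hit
  split_ifs <;> positivity

/-- The values are `0` and `1`, so second moments of single hits equal their means. -/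
theorem hit_sq (I : Set V) (u v : V) (x : V × Bool) : hit I u v x ^ 2 = hit I u v x := by
  by_cases h1 : u ∈ I
  · simp [hit, chi, h1]
  by_cases h2 : v = u
  · subst h2
    simp only [hit, chi_of_notMem h1, if_true, zero_mul, add_zero, mul_pow, chi_sq, ok_sq]
  · simp only [hit, if_neg h2, zero_add, mul_pow, chi_sq, ok_sq]
    split_ifs <;> simp

variable [Fintype V]

theorem sum_hit_eq (I : Set V) (v : V) (x : V × Bool) :
    ∑ u, hit I u v x = (chi Iᶜ v * chi I x.1 + chi I v * chi Iᶜ x.1) * ok x.2 := by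
  simp only [hit, ← Finset.sum_mul]
  congr 1
  simp only [mul_add, Finset.sum_add_distrib, mul_ite, mul_zero, mul_one, Finset.sum_ite_eq,
    Finset.mem_univ, if_true]
  ring

/-- A call informs at most one of its two ends; this bounds the influence of each independent call.
-/
theorem sum_hit_le_one (I : Set V) (v : V) (x : V × Bool) : ∑ u, hit I u v x ≤ 1 := by
  rw [sum_hit_eq]
  refine mul_le_one₀ ?_ (ok_nonneg _) (ok_le_one _)
  have h1 := chi_nonneg I v
  have h2 := chi_le_one I v
  have h3 := chi_nonneg I x.1
  have h4 := chi_le_one I x.1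
  rw [chi_compl, chi_compl]
  nlinarith

/-- The number of calls that inform the uninformed vertex `u`. -/
def hits (I : Set V) (u : V) (ρ : Round V) : ℝ := ∑ v, hit I u v (ρ v)

theorem hits_le_sq (I : Set V) (u : V) (ρ : Round V) : hits I u ρ ≤ hits I u ρ ^ 2 := by
  have h : ∀ v, hit I u v (ρ v) ≤ hits I u ρ := fun v =>
    Finset.single_le_sum (f := fun v => hit I u v (ρ v)) (fun v _ => hit_nonneg I u v _)
      (Finset.mem_univ v)
  calc hits I u ρ = ∑ v, hit I u v (ρ v) * hit I u v (ρ v) := by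
        simp only [← sq, hit_sq]; rfl
    _ ≤ ∑ v, hits I u ρ * hit I u v (ρ v) :=
        Finset.sum_le_sum fun v _ => mul_le_mul_of_nonneg_right (h v) (hit_nonneg I u v _)
    _ = hits I u ρ ^ 2 := by rw [← Finset.mul_sum, sq]; rfl

/-- With `N` hits on an uninformed `u`, `2N - N²` vanishes for `N = 0` and never exceeds `1`. It
equals `N - (N² - N)`: the sum of independent hits minus a correction for multiple hits. -/
theorem le_chi_pushPull (ρ : Round V) (I : Set V) (u : V) :
    chi I u + (2 * hits I u ρ - hits I u ρ ^ 2) ≤ chi (pushPull ρ I) u := by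
  by_cases h1 : u ∈ I
  · have h2 : hits I u ρ = 0 := by simp [hits, hit, chi, h1]
    have h3 : u ∈ pushPull ρ I := Or.inl (Or.inl h1)
    rw [h2, chi_of_mem h1, chi_of_mem h3]; norm_num
  rw [chi_of_notMem h1]
  by_cases h3 : u ∈ pushPull ρ I
  · rw [chi_of_mem h3]; nlinarith [sq_nonneg (hits I u ρ - 1)]
  · have h2 : hits I u ρ = 0 := by
      refine Finset.sum_eq_zero fun v _ => ?_
      have h4 : ¬ ((ρ u).1 ∈ I ∧ (ρ u).2 = true) := fun h => h3 (Or.inl (Or.inr h))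
      have h5 : ¬ (v ∈ I ∧ (ρ v).1 = u ∧ (ρ v).2 = true) := fun h => h3 (Or.inr ⟨v, h⟩)
      by_cases hv : v = u
      · subst hv
        by_cases h6 : (ρ v).1 ∈ I <;> by_cases h7 : (ρ v).2 = true <;>
          simp_all [hit, ok, chi]
      · by_cases h6 : v ∈ I <;> by_cases h7 : (ρ v).2 = true <;>
          by_cases h8 : (ρ v).1 = u <;> simp_all [hit, ok, chi]
    rw [h2, chi_of_notMem h3]; norm_num

variable [MeasurableSpace V] [MeasurableSingletonClass V]
  {H : SimpleGraph V} [DecidableRel H.Adj] {D θ c : ℝ}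

theorem integral_hit (hdeg : ∀ u, 0 < rdeg H u) (q : unitInterval) (I : Set V) (u v : V) :
    ∫ x, hit I u v x ∂(callMeasure H q v) =
      q * (chi Iᶜ u * ((if v = u then degIn H I v / rdeg H v else 0) +
        chi I v * (H.adjMatrix ℝ v u / rdeg H v))) := by
  unfold hit
  rw [integral_callMeasure H q (hdeg v) (fun w => chi Iᶜ u * ((if v = u then chi I w else 0) +
    chi I v * (if w = u then 1 else 0)))]
  congr 1
  have h1 : ∀ w, H.adjMatrix ℝ v w * (chi Iᶜ u * ((if v = u then chi I w else 0) +
      chi I v * (if w = u then 1 else 0))) =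
      chi Iᶜ u * ((if v = u then H.adjMatrix ℝ v w * chi I w else 0) +
        chi I v * (if w = u then H.adjMatrix ℝ v w else 0)) := fun w => by
    split_ifs <;> ring
  simp only [h1, ← Finset.mul_sum, Finset.sum_add_distrib, Finset.sum_ite_eq', Finset.mem_univ,
    if_true]
  split_ifs with h
  · simp only [degIn]; ring
  · rw [Finset.sum_const_zero]; ring

/-- The expected number of calls that inform `u`. -/
theorem sum_integral_hit (hdeg : ∀ u, 0 < rdeg H u) (q : unitInterval) (I : Set V) (u : V) :
    ∑ v, ∫ x, hit I u v x ∂(callMeasure H q v) =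
      q * (chi Iᶜ u * ∑ v, H.adjMatrix ℝ u v * chi I v * (1 / rdeg H u + 1 / rdeg H v)) := by
  simp only [integral_hit hdeg, ← Finset.mul_sum, Finset.sum_add_distrib, Finset.sum_ite_eq',
    Finset.mem_univ, if_true]
  congr 2
  rw [degIn, Finset.sum_div, ← Finset.sum_add_distrib]
  refine Finset.sum_congr rfl fun v _ => ?_
  rw [adjMatrix_symm H v u]
  ring

theorem WellSpread.sum_integral_hit_le (hH : WellSpread H D θ c) (q : unitInterval) (I : Set V)
    (u : V) :
    ∑ v, ∫ x, hit I u v x ∂(callMeasure H q v) ≤ 4 / D * (chi Iᶜ u * degIn H I u) := by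
  have hD := hH.pos
  have hinv : ∀ v, 1 / rdeg H v ≤ 2 / D := fun v => by
    rw [div_le_div_iff₀ (hH.rdeg_pos v) hD]
    linarith [hH.half_le_rdeg v]
  rw [sum_integral_hit hH.rdeg_pos]
  have h0 : 0 ≤ ∑ v, H.adjMatrix ℝ u v * chi I v * (1 / rdeg H u + 1 / rdeg H v) :=
    Finset.sum_nonneg fun v _ => mul_nonneg (mul_nonneg (adjMatrix_nonneg H u v) (chi_nonneg I v))
      (add_nonneg (one_div_nonneg.2 (hH.rdeg_pos u).le) (one_div_nonneg.2 (hH.rdeg_pos v).le))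
  refine (mul_le_of_le_one_left (mul_nonneg (chi_nonneg _ _) h0) q.2.2).trans ?_
  rw [mul_left_comm]
  refine mul_le_mul_of_nonneg_left ?_ (chi_nonneg _ _)
  rw [degIn, Finset.mul_sum]
  refine Finset.sum_le_sum fun v _ => ?_
  rw [mul_comm]
  refine mul_le_mul_of_nonneg_right ?_ (mul_nonneg (adjMatrix_nonneg H u v) (chi_nonneg I v))
  have := hinv u
  have := hinv v
  have e : 4 / D = 2 / D + 2 / D := by ring
  linarith

/-- With the weights `√d`, the expected gain is twice the weight of the informed set, up to the
edges inside this set. -/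
theorem WellSpread.le_sum_sqrt_mul_integral_hit (hH : WellSpread H D θ c) (I : Set V) :
    2 * (wt (fun u => √(rdeg H u)) I - 1 / √(D / 2) * wt (degIn H I) I) ≤
      ∑ u, √(rdeg H u) * ∑ v, ∫ x, hit I u v x ∂(callMeasure H 1 v) := by
  have hD := hH.pos
  have hs0 : ∀ u, 0 < √(rdeg H u) := fun u => Real.sqrt_pos.2 (hH.rdeg_pos u)
  have hsq : ∀ u, √(rdeg H u) * √(rdeg H u) = rdeg H u := fun u =>
    Real.mul_self_sqrt (hH.rdeg_pos u).le
  have hinv : ∀ u, 1 / √(rdeg H u) ≤ 1 / √(D / 2) := fun u =>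
    one_div_le_one_div_of_le (Real.sqrt_pos.2 (by linarith)) (Real.sqrt_le_sqrt (hH.half_le_rdeg u))
  -- This is where the weights `√d` are needed: AM-GM balances the pull along an edge against the
  -- push.
  have hamgm : ∀ u v, 2 * (1 / √(rdeg H v)) ≤ √(rdeg H u) * (1 / rdeg H u + 1 / rdeg H v) := by
    intro u v
    have h1 := hs0 u
    have h2 := hs0 v
    have h3 : ∀ a b : ℝ, 0 < a → 0 < b → 2 * (1 / b) ≤ a * (1 / (a * a) + 1 / (b * b)) := by
      intro a b ha hb
      have e : a * (1 / (a * a) + 1 / (b * b)) - 2 * (1 / b) = (a - b) ^ 2 / (a * b ^ 2) := by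
        field_simp; ring
      have : 0 ≤ (a - b) ^ 2 / (a * b ^ 2) := by positivity
      linarith
    simpa only [hsq] using h3 _ _ h1 h2
  calc 2 * (wt (fun u => √(rdeg H u)) I - 1 / √(D / 2) * wt (degIn H I) I)
      ≤ 2 * ∑ v, chi I v * (1 / √(rdeg H v) * degIn H Iᶜ v) := by
        rw [wt, wt, Finset.mul_sum, ← Finset.sum_sub_distrib]
        gcongr with v
        rw [mul_left_comm, ← mul_sub]
        refine mul_le_mul_of_nonneg_left ?_ (chi_nonneg I v)
        rw [degIn_compl, mul_sub]
        refine sub_le_sub (le_of_eq ?_)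
          (mul_le_mul_of_nonneg_right (hinv v) (degIn_nonneg H I v))
        rw [one_div, ← div_eq_inv_mul, Real.div_sqrt]
    _ = ∑ v, ∑ u, chi Iᶜ u * (H.adjMatrix ℝ u v * chi I v * (2 * (1 / √(rdeg H v)))) := by
        rw [Finset.mul_sum]
        refine Finset.sum_congr rfl fun v _ => ?_
        simp only [degIn, Finset.mul_sum]
        refine Finset.sum_congr rfl fun u _ => ?_
        rw [adjMatrix_symm H v u]; ring
    _ ≤ ∑ v, ∑ u, chi Iᶜ u * (H.adjMatrix ℝ u v * chi I v *
          (√(rdeg H u) * (1 / rdeg H u + 1 / rdeg H v))) := by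
        refine Finset.sum_le_sum fun v _ => Finset.sum_le_sum fun u _ => ?_
        exact mul_le_mul_of_nonneg_left (mul_le_mul_of_nonneg_left (hamgm u v)
          (mul_nonneg (adjMatrix_nonneg H u v) (chi_nonneg I v))) (chi_nonneg _ _)
    _ = _ := by
        rw [Finset.sum_comm]
        refine Finset.sum_congr rfl fun u _ => ?_
        rw [sum_integral_hit hH.rdeg_pos]
        simp only [Set.Icc.coe_one, one_mul, Finset.mul_sum]
        exact Finset.sum_congr rfl fun v _ => by ring

/-- The weight of small sets, that are not too small, grows by a factor close to `3`. -/
theorem WellSpread.transition_pushPull_inv_le_of_small (hH : WellSpread H D θ c) {K κ : ℝ}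
    (hK : 0 < K) {I : Set V} (hI : K ≤ sz I) (hI2 : sz I ≤ κ * Fintype.card V)
    (hκ : 2 * (κ + θ) ≤ 1) :
    transition pushPull (roundMeasure H 1) (fun J => 1 / wt (fun u => √(rdeg H u)) J) I ≤
      (1 / (1 + 2 * (1 - 2 * (κ + θ))) + 16 / K + 64 * (κ + θ)) *
        (1 / wt (fun u => √(rdeg H u)) I) := by
  have hD := hH.pos
  set s : V → ℝ := fun u => √(rdeg H u) with hs
  set r := √(D / 2) with hr
  have hr0 : 0 < r := Real.sqrt_pos.2 (by linarith)
  have hDr : D = 2 * (r * r) := by rw [hr, Real.mul_self_sqrt (by linarith)]; ring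
  have hs1 : ∀ u, r ≤ s u := fun u => Real.sqrt_le_sqrt (hH.half_le_rdeg u)
  have hs0 : ∀ u, 0 ≤ s u := fun u => hr0.le.trans (hs1 u)
  have hs2 : ∀ u, s u ≤ 2 * r := fun u => by
    refine Real.sqrt_le_iff.2 ⟨by positivity, (hH.rdeg_le u).trans ?_⟩
    nlinarith
  have hI0 : 0 < sz I := by linarith
  have hn0 : (0 : ℝ) < Fintype.card V := by
    have := sz_mono (Set.subset_univ I)
    rw [sz_univ] at this
    linarith
  have hszκ : sz I / Fintype.card V ≤ κ := by rwa [div_le_iff₀ hn0]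
  have hκθ : 0 ≤ κ + θ := add_nonneg (le_trans (by positivity) hszκ) hH.error_nonneg
  set W := wt s I with hW
  have hWr : r * sz I ≤ W := by rw [← wt_const]; exact wt_mono hs1 I
  have hW0 : 0 < W := lt_of_lt_of_le (by positivity) hWr
  set g : V → V × Bool → ℝ := fun v x => ∑ u, s u * hit I u v x with hg
  have hg0 : ∀ v x, 0 ≤ g v x := fun v x =>
    Finset.sum_nonneg fun u _ => mul_nonneg (hs0 u) (hit_nonneg I u v x)
  have hgr : ∀ v x, g v x ≤ 2 * r := fun v x => by
    calc g v x ≤ ∑ u, 2 * r * hit I u v x :=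
          Finset.sum_le_sum fun u _ => mul_le_mul_of_nonneg_right (hs2 u) (hit_nonneg I u v x)
      _ = 2 * r * ∑ u, hit I u v x := by rw [Finset.mul_sum]
      _ ≤ 2 * r := mul_le_of_le_one_right (by positivity) (sum_hit_le_one I v x)
  set EN : V → ℝ := fun u => ∑ v, ∫ x, hit I u v x ∂(callMeasure H 1 v) with hEN
  have hEN0 : ∀ u, 0 ≤ EN u := fun u =>
    Finset.sum_nonneg fun v _ => integral_nonneg fun x => hit_nonneg I u v x
  have hENle : ∀ u, EN u ≤ 4 / D * (chi Iᶜ u * degIn H I u) := fun u =>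
    hH.sum_integral_hit_le 1 I u
  set M := ∑ u, s u * EN u with hM
  have hgsum : ∑ v, ∫ x, g v x ∂(callMeasure H 1 v) = M := by
    have : ∀ v, ∫ x, g v x ∂(callMeasure H 1 v) =
        ∑ u, s u * ∫ x, hit I u v x ∂(callMeasure H 1 v) := fun v => by
      simp only [hg]
      rw [integral_finsetSum _ fun u _ => Integrable.of_finite]
      simp only [integral_const_mul]
    simp only [this]
    rw [Finset.sum_comm]
    simp only [hM, hEN, Finset.mul_sum]
  have hMle : M ≤ 8 * r * sz I := by
    calc M ≤ ∑ u, 2 * r * (4 / D * (chi Iᶜ u * degIn H I u)) := by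
          refine Finset.sum_le_sum fun u _ => ?_
          exact mul_le_mul (hs2 u) (hENle u) (hEN0 u) (by positivity)
      _ = 8 * r / D * wt (degIn H Iᶜ) I := by
          rw [← wt_degIn_symm, wt, Finset.mul_sum]
          exact Finset.sum_congr rfl fun u _ => by ring
      _ ≤ 8 * r / D * (D * sz I) := by
          gcongr
          refine le_trans ?_ (hH.vol_le I)
          exact wt_mono (degIn_le_rdeg H Iᶜ) I
      _ = _ := by field_simp
  have hMge : 2 * (1 - 2 * (κ + θ)) * W ≤ M := by
    have h1 := hH.le_sum_sqrt_mul_integral_hit I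
    have h2 : 1 / r * wt (degIn H I) I ≤ 2 * (κ + θ) * W := by
      calc 1 / r * wt (degIn H I) I ≤ 1 / r * ((κ + θ) * D * sz I) := by
            gcongr
            exact (hH.inner_le I).trans (by gcongr)
        _ = 2 * (κ + θ) * (r * sz I) := by rw [hDr]; field_simp
        _ ≤ _ := by gcongr
    change 2 * (W - 1 / r * wt (degIn H I) I) ≤ M at h1
    linarith
  have hvar : ∑ v, ∫ x, g v x ^ 2 ∂(callMeasure H 1 v) ≤ 16 * r ^ 2 * sz I := by
    calc ∑ v, ∫ x, g v x ^ 2 ∂(callMeasure H 1 v)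
        ≤ ∑ v, ∫ x, 2 * r * g v x ∂(callMeasure H 1 v) := by
          refine Finset.sum_le_sum fun v _ =>
            integral_mono Integrable.of_finite Integrable.of_finite fun x => ?_
          have := mul_le_mul_of_nonneg_right (hgr v x) (hg0 v x)
          change g v x ^ 2 ≤ 2 * r * g v x
          linarith
      _ = 2 * r * M := by simp only [integral_const_mul, ← Finset.mul_sum, hgsum]
      _ ≤ 2 * r * (8 * r * sz I) := by gcongr
      _ = _ := by ring
  -- The weighted overcount when a vertex is hit more than once.
  set C : Round V → ℝ := fun ρ => ∑ u, s u * (hits I u ρ ^ 2 - hits I u ρ) with hC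
  have hC0 : ∀ ρ, 0 ≤ C ρ := fun ρ => Finset.sum_nonneg fun u _ =>
    mul_nonneg (hs0 u) (sub_nonneg.2 (hits_le_sq I u ρ))
  have hEC : ∫ ρ, C ρ ∂(roundMeasure H 1) ≤ 64 * (κ + θ) * (r * sz I) := by
    -- By independence and `hit_sq`, `E[N² - N] ≤ (E N)²`, and `E N` is at most `4/D` times the
    -- number of informed neighbours. Hence the bound through the sum of squared degrees.
    have hsq : ∀ u, ∫ ρ, hits I u ρ ^ 2 ∂(roundMeasure H 1) ≤ EN u ^ 2 + EN u := fun u => by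
      have h := integral_round_sum_sq_le H 1 (hit I u)
      simp only [hit_sq] at h
      exact h
    have hfirst : ∀ u, ∫ ρ, hits I u ρ ∂(roundMeasure H 1) = EN u := fun u =>
      integral_round_sum H 1 (hit I u)
    calc ∫ ρ, C ρ ∂(roundMeasure H 1)
        = ∑ u, s u * (∫ ρ, hits I u ρ ^ 2 ∂(roundMeasure H 1) - EN u) := by
          simp only [hC]
          rw [integral_finsetSum _ fun u _ => integrable_round _ _]
          refine Finset.sum_congr rfl fun u _ => ?_
          rw [integral_const_mul, integral_sub (integrable_round _ _) (integrable_round _ _),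
            hfirst]
      _ ≤ ∑ u, 2 * r * (4 / D * degIn H I u) ^ 2 := by
          refine Finset.sum_le_sum fun u _ => ?_
          have h1 : EN u ≤ 4 / D * degIn H I u := (hENle u).trans
            (mul_le_mul_of_nonneg_left (mul_le_of_le_one_left (degIn_nonneg H I u)
              (chi_le_one _ _)) (by positivity))
          calc s u * (∫ ρ, hits I u ρ ^ 2 ∂(roundMeasure H 1) - EN u) ≤ s u * EN u ^ 2 :=
                mul_le_mul_of_nonneg_left (by linarith [hsq u]) (hs0 u)
            _ ≤ 2 * r * (4 / D * degIn H I u) ^ 2 :=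
                mul_le_mul (hs2 u) (pow_le_pow_left₀ (hEN0 u) h1 2) (sq_nonneg _) (by positivity)
      _ = 32 * r / D ^ 2 * ∑ u, degIn H I u ^ 2 := by
          rw [Finset.mul_sum]
          exact Finset.sum_congr rfl fun u _ => by ring
      _ ≤ 32 * r / D ^ 2 * (2 * (κ + θ) * D ^ 2 * sz I) := by
          gcongr
          exact (hH.sum_sq_le I).trans (by gcongr)
      _ = _ := by field_simp; ring
  have hsumhits : ∀ ρ : Round V, ∑ u, s u * hits I u ρ = ∑ v, g v (ρ v) := fun ρ => by
    simp only [hits, hg, Finset.mul_sum]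
    rw [Finset.sum_comm]
  have hmono : ∀ ρ, W ≤ wt s (pushPull ρ I) := fun ρ =>
    wt_mono_set hs0 ((subset_pull ρ I).trans (pull_subset_pushPull ρ I))
  have hmain := integral_inv_le (roundMeasure H 1) (X := W) (M := M) (v := 16 * r ^ 2 * sz I)
    hW0 (Y := fun ρ => wt s (pushPull ρ I) - W) (S := fun ρ => ∑ v, g v (ρ v)) (C := C)
    (fun ρ => sub_nonneg.2 (hmono ρ))
    (fun ρ => Finset.sum_nonneg fun v _ => hg0 v _) hC0
    (fun ρ => by
      rw [← hsumhits]
      simp only [hW, wt, hC, ← Finset.sum_sub_distrib, ← Finset.sum_add_distrib]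
      refine Finset.sum_le_sum fun u _ => ?_
      have h1 := mul_le_mul_of_nonneg_right (le_chi_pushPull ρ I u) (hs0 u)
      linarith)
    (by rw [integral_round_sum H 1 g, hgsum])
    (by
      refine le_trans ?_ hvar
      rw [← hgsum]
      exact integral_round_sum_sub_sq_le H 1 g)
  simp only [transition]
  simp only [add_sub_cancel] at hmain
  refine hmain.trans ?_
  rw [add_mul, add_mul]
  refine add_le_add (add_le_add ?_ ?_) ?_
  · rw [one_div_mul_one_div]
    refine one_div_le_one_div_of_le (mul_pos (by linarith) hW0) ?_
    linarith
  · calc 16 * r ^ 2 * sz I / W ^ 3 = 16 / sz I * ((r * sz I) ^ 2 / W ^ 3) := by field_simp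
      _ ≤ 16 / K * (W ^ 2 / W ^ 3) := by gcongr
      _ = _ := by field_simp
  · calc (∫ ρ, C ρ ∂(roundMeasure H 1)) / W ^ 2 ≤ 64 * (κ + θ) * W / W ^ 2 := by
          gcongr
          exact hEC.trans (by gcongr)
      _ = _ := by field_simp

end PushPull

/-! ### Bounds for a fixed graph -/

section FixedGraph

variable {V : Type*} [Fintype V]

theorem absorbing_le_sz {P : Protocol V} (hP : ∀ ρ I, pull ρ I ⊆ P ρ I) (a : ℝ) :
    Absorbing P {I | a ≤ sz I} := fun ρ I hI =>
  le_trans hI (sz_mono ((subset_pull ρ I).trans (hP ρ I)))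

theorem absorbing_sz_compl_le {P : Protocol V} (hP : ∀ ρ I, pull ρ I ⊆ P ρ I) (a : ℝ) :
    Absorbing P {I | sz Iᶜ ≤ a} := fun ρ I hI =>
  le_trans (sz_mono (Set.compl_subset_compl.2 ((subset_pull ρ I).trans (hP ρ I)))) hI

variable [MeasurableSpace V] [MeasurableSingletonClass V]
  {H : SimpleGraph V} [DecidableRel H.Adj] {D θ c : ℝ}

theorem transition_le_transition_pull {P : Protocol V} {μ : Measure (Round V)} [IsFiniteMeasure μ]
    {F : Set V → ℝ} {I : Set V} (h : ∀ ρ, F (P ρ I) ≤ F (pull ρ I)) :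
    transition P μ F I ≤ transition pull μ F I :=
  integral_mono (integrable_round μ _) (integrable_round μ _) h

/-- In the range from `1 / x` to `x * n` informed vertices, some weight function, constant up to
a factor `2`, grows by a factor `1 / β`, in the sense of reciprocal means. -/
def Grows (H : SimpleGraph V) [DecidableRel H.Adj] (q : unitInterval) (P : Protocol V)
    (x β : ℝ) : Prop :=
  ∃ (s : V → ℝ) (r : ℝ), 0 < r ∧ (∀ u, r ≤ s u) ∧ (∀ u, s u ≤ 2 * r) ∧
    ∀ I, 1 / x ≤ sz I → sz I ≤ x * Fintype.card V →
      transition P (roundMeasure H q) (fun J => 1 / wt s J) I ≤ β * (1 / wt s I)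

variable (q : unitInterval) {P : Protocol V}

/-- Only the constant number `K` of vertices has to be reached, so any fixed growth rate suffices.
As `P` informs at least what pull does, the estimate for pull applies. The factor `2` compares the
degree of the starting vertex with `D`. -/
theorem WellSpread.start_le (hP : ∀ ρ I, pull ρ I ⊆ P ρ I)
    (hH : WellSpread H D θ c) (hc : 0 ≤ c) (hc1 : c ≤ 1) {K : ℝ}
    (hKn : K ≤ Fintype.card V / 2) (hK : 0 < K) (t : ℕ) (v : V) :
    (transition P (roundMeasure H q))^[t] (ind {I | K ≤ sz I}ᶜ) {v} ≤
      (1 - q * c / 16) ^ t * (2 * K) := by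
  have hD := hH.pos
  have hq0 := q.2.1
  have hq1 := q.2.2
  have hqc : q * c ≤ 1 := mul_le_one₀ hq1 hc hc1
  have hvol : ∀ I : Set V, I.Nonempty → 0 < wt (rdeg H) I := fun I hI => by
    have := one_le_sz hI
    exact lt_of_lt_of_le (by positivity) (hH.le_vol I)
  have hR : Absorbing P {I : Set V | I.Nonempty} := fun ρ I hI =>
    Set.Nonempty.mono ((subset_pull ρ I).trans (hP ρ I)) hI
  refine (transition_iterate_ind_le P (roundMeasure H q) hR (absorbing_le_sz hP K)
    (h := fun J => 1 / wt (rdeg H) J) (β := 1 - q * c / 16) (m := 1 / (D * K)) (by linarith)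
    (by positivity) (fun I => one_div_nonneg.2 (wt_nonneg (fun u => (hH.rdeg_pos u).le) I))
    (fun I hI hIB => ?_) (fun I hI hIB => ?_) t (Set.singleton_nonempty v)).trans ?_
  · have hIB : sz I < K := not_le.1 hIB
    refine one_div_le_one_div_of_le (hvol I hI) ((hH.vol_le I).trans ?_)
    gcongr
  · have hIB : sz I < K := not_le.1 hIB
    refine (transition_le_transition_pull fun ρ => ?_).trans
      (hH.transition_pull_inv_vol_le_of_le_half q hc hI (by linarith))
    refine one_div_le_one_div_of_le (hvol _ (Set.Nonempty.mono (subset_pull ρ I) hI)) ?_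
    exact wt_mono_set (fun u => (hH.rdeg_pos u).le) (hP ρ I)
  · refine mul_le_mul_of_nonneg_left ?_ (pow_nonneg (by linarith) t)
    rw [wt_singleton, div_div_eq_mul_div, div_one, div_mul_eq_mul_div, one_mul,
      div_le_iff₀ (hH.rdeg_pos v)]
    nlinarith [hH.half_le_rdeg v]

/-- The phase with the sharp rate: the weight can grow in total by a factor of at most `2 n`, which
takes about `log n / log (1/β)` rounds. -/
theorem Grows.growth_le (hP : ∀ ρ I, pull ρ I ⊆ P ρ I)
    {x β : ℝ} (hgr : Grows H q P x β) (hβ : 0 ≤ β) (hx : 0 < x)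
    (hx1 : x ≤ 1) (t : ℕ) {I : Set V} (hI : 1 / x ≤ sz I) :
    (transition P (roundMeasure H q))^[t] (ind {J | x * Fintype.card V ≤ sz J}ᶜ) I ≤
      β ^ t * (2 * Fintype.card V) := by
  obtain ⟨s, r, hr, hs1, hs2, hd⟩ := hgr
  have hx2 : 1 ≤ 1 / x := by rw [le_div_iff₀ hx]; linarith
  have hs0 : ∀ u, 0 ≤ s u := fun u => hr.le.trans (hs1 u)
  have hws : ∀ J : Set V, r * sz J ≤ wt s J := fun J => by rw [← wt_const]; exact wt_mono hs1 J
  have hws2 : ∀ J : Set V, wt s J ≤ 2 * r * sz J := fun J => by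
    rw [← wt_const]; exact wt_mono hs2 J
  have hn0 : (0 : ℝ) < Fintype.card V := by
    have := sz_mono (Set.subset_univ I)
    rw [sz_univ] at this
    linarith
  refine (transition_iterate_ind_le P (roundMeasure H q) (absorbing_le_sz hP (1 / x))
    (absorbing_le_sz hP (x * Fintype.card V)) (h := fun J => 1 / wt s J) (β := β)
    (m := 1 / (2 * r * Fintype.card V)) hβ
    (by positivity) (fun J => one_div_nonneg.2 (wt_nonneg hs0 J))
    (fun J hJ hJB => ?_) (fun J hJ hJB => hd J hJ (not_le.1 hJB).le) t hI).trans ?_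
  · have hJ : 1 / x ≤ sz J := hJ
    have h1 : 0 < wt s J := lt_of_lt_of_le (mul_pos hr (by linarith)) (hws J)
    refine one_div_le_one_div_of_le h1 ((hws2 J).trans ?_)
    gcongr
    rw [← sz_univ]
    exact sz_mono (Set.subset_univ J)
  · gcongr
    rw [div_div_eq_mul_div, div_one, div_mul_eq_mul_div, one_mul]
    have h1 : r ≤ wt s I := le_trans (by nlinarith) (hws I)
    rw [div_le_iff₀ (by linarith)]
    nlinarith

/-- The uninformed volume only has to fall by a constant factor, about `2/κ`, so edge expansion with
a crude rate is enough. -/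
theorem WellSpread.middle_le (hP : ∀ ρ I, pull ρ I ⊆ P ρ I)
    (hH : WellSpread H D θ c) (hc : 0 ≤ c) (hc1 : c ≤ 1) {κ : ℝ}
    (hκ0 : 0 < κ) (hκ1 : κ ≤ 1) (hn0 : (0 : ℝ) < Fintype.card V) (t : ℕ) {I : Set V}
    (hI : κ * Fintype.card V ≤ sz I) :
    (transition P (roundMeasure H q))^[t] (ind {J | sz Jᶜ ≤ κ * Fintype.card V}ᶜ) I ≤
      (1 - q * c * κ) ^ t * (2 / κ) := by
  have hD := hH.pos
  have hq0 := q.2.1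
  have hq1 := q.2.2
  have hqc : q * c * κ ≤ 1 := mul_le_one₀ (mul_le_one₀ hq1 hc hc1) hκ0.le hκ1
  have hd0 : ∀ u, 0 ≤ rdeg H u := fun u => (hH.rdeg_pos u).le
  refine (transition_iterate_ind_le P (roundMeasure H q)
    (absorbing_le_sz hP (κ * Fintype.card V)) (absorbing_sz_compl_le hP (κ * Fintype.card V))
    (h := fun J => wt (rdeg H) Jᶜ) (β := 1 - q * c * κ) (m := D / 2 * (κ * Fintype.card V))
    (by linarith) (by positivity) (fun J => wt_nonneg hd0 _) (fun J hJ hJB => ?_)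
    (fun J hJ hJB => ?_) t hI).trans ?_
  · refine le_trans ?_ (hH.le_vol Jᶜ)
    gcongr
    exact (not_le.1 hJB).le
  · refine (transition_le_transition_pull fun ρ => ?_).trans
      (hH.transition_pull_vol_compl_le q hc hκ0.le hκ1 hJ)
    exact wt_mono_set hd0 (Set.compl_subset_compl.2 (hP ρ J))
  · refine mul_le_mul_of_nonneg_left ?_ (pow_nonneg (by linarith) t)
    have h1 : sz Iᶜ ≤ Fintype.card V := by rw [← sz_univ]; exact sz_mono (Set.subset_univ _)
    rw [div_le_div_iff₀ (by positivity) hκ0]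
    calc wt (rdeg H) Iᶜ * κ ≤ D * Fintype.card V * κ := by
          gcongr
          exact (hH.vol_le _).trans (by gcongr)
      _ = _ := by ring

/-- Here the number of uninformed vertices contracts. It is an integer, so below `1` it is zero. -/
theorem WellSpread.finish_le (hP : ∀ ρ I, pull ρ I ⊆ P ρ I)
    (hH : WellSpread H D θ c) {κ : ℝ} (hκ : 0 ≤ κ) (t : ℕ) {I : Set V}
    (hI : sz Iᶜ ≤ κ * Fintype.card V) :
    (transition P (roundMeasure H q))^[t] (ind {Set.univ}ᶜ) I ≤
      (1 - q * (1 - 2 * (κ + θ))) ^ t * Fintype.card V := by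
  have hq0 := q.2.1
  have hq1 := q.2.2
  have hβ : 0 ≤ 1 - q * (1 - 2 * (κ + θ)) := by
    have := mul_nonneg hq0 (add_nonneg hκ hH.error_nonneg)
    linarith
  refine (transition_iterate_ind_le P (roundMeasure H q)
    (absorbing_sz_compl_le hP (κ * Fintype.card V)) (B := {Set.univ}) (fun ρ I hI => ?_)
    (h := fun J => sz Jᶜ) (β := 1 - q * (1 - 2 * (κ + θ))) (m := 1)
    hβ one_pos (fun J => sz_nonneg _) (fun J hJ hJB => ?_)
    (fun J hJ hJB => ?_) t hI).trans ?_
  · rw [Set.mem_singleton_iff] at hI ⊢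
    refine Set.univ_subset_iff.1 ?_
    calc Set.univ = I := hI.symm
      _ ⊆ _ := (subset_pull ρ I).trans (hP ρ I)
  · exact one_le_sz (Set.nonempty_compl.2 hJB)
  · refine (transition_le_transition_pull fun ρ => ?_).trans (hH.transition_pull_sz_compl_le q hJ)
    exact sz_mono (Set.compl_subset_compl.2 (hP ρ J))
  · rw [div_one]
    gcongr
    rw [← sz_univ]; exact sz_mono (Set.subset_univ _)

/-- The probability that some vertex is still uninformed. -/
theorem WellSpread.transition_iterate_ne_univ_le (hP : ∀ ρ I, pull ρ I ⊆ P ρ I)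
    {x β : ℝ} (hH : WellSpread H D x c) (hc : 0 ≤ c)
    (hc1 : c ≤ 1) (hgr : Grows H q P x β) (hβ : 0 ≤ β) (hx : 0 < x) (hx1 : x ≤ 1)
    (hn : 2 / x ≤ Fintype.card V) (t₀ t₁ t₂ t₃ : ℕ) (v : V) :
    (transition P (roundMeasure H q))^[t₀ + (t₁ + (t₂ + t₃))] (ind {Set.univ}ᶜ) {v} ≤
      (1 - q * c / 16) ^ t₀ * (2 / x) + (β ^ t₁ * (2 * Fintype.card V) +
        ((1 - q * c * x) ^ t₂ * (2 / x) + (1 - q * (1 - 4 * x)) ^ t₃ * Fintype.card V)) := by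
  have hq0 := q.2.1
  have hq1 := q.2.2
  have hx2 : 0 < 2 / x := by positivity
  have hn0 : (0 : ℝ) < Fintype.card V := hx2.trans_le hn
  have h2 : (0 : ℝ) ≤ 1 - q * c * x := by
    have := mul_le_one₀ (mul_le_one₀ hq1 hc hc1) hx.le hx1
    linarith
  have h3 : (0 : ℝ) ≤ 1 - q * (1 - 4 * x) := by nlinarith
  have e2 : (2 : ℝ) / x = 2 * (1 / x) := by ring
  -- The phases are chained at the thresholds `1/x` informed, `x n` informed and `x n` uninformed;
  -- the failure probabilities add.
  refine (transition_iterate_add_le P _ {I | 1 / x ≤ sz I} _ t₀ _ _ ?_ fun I hI => ?_).trans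
    (add_le_add_left ?_ _)
  · positivity
  · refine (transition_iterate_add_le P _ {I | x * Fintype.card V ≤ sz I} _ t₁ _ _ ?_
      fun J hJ => ?_).trans (add_le_add_left (hgr.growth_le q hP hβ hx hx1 t₁ hI) _)
    · positivity
    · refine (transition_iterate_add_le P _ {I | sz Iᶜ ≤ x * Fintype.card V} _ t₂ _ _ ?_
        fun L hL => ?_).trans
        (add_le_add_left (hH.middle_le q hP hc hc1 hx hx1 hn0 t₂ hJ) _)
      · positivity
      · have h := hH.finish_le q hP hx.le t₃ hL
        rwa [show 2 * (x + x) = 4 * x by ring] at h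
  · have h := hH.start_le q hP hc hc1 (K := 1 / x) (by rw [e2] at hn; linarith) (by positivity) t₀ v
    rwa [← e2] at h

/-- The probability that pull has already informed all vertices. -/
theorem WellSpread.transition_iterate_pull_univ_le (hH : WellSpread H D θ c)
    (hn0 : (0 : ℝ) < Fintype.card V) (s t : ℕ) (v : V) :
    (transition pull (roundMeasure H q))^[s + t] (ind {Set.univ}) {v} ≤
      4 * ((1 + q) ^ s / Fintype.card V) +
        Real.exp (-((1 - q) ^ t * Fintype.card V / 2)) := by
  have hD := hH.pos
  have hq0 := q.2.1
  have hq1 := q.2.2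
  have hd0 : ∀ u, 0 ≤ rdeg H u := fun u => (hH.rdeg_pos u).le
  set n : ℝ := ((Fintype.card V : ℕ) : ℝ) with hn
  refine (transition_iterate_add_le pull _ {I | sz I < n / 2} _ s t _ (Real.exp_nonneg _)
    fun I hI => ?_).trans (add_le_add_left ?_ _)
  · refine (RumorSpreading.transition_iterate_pull_univ_le H q hH.rdeg_pos t I).trans ?_
    refine Real.exp_le_exp.2 (neg_le_neg ?_)
    rw [mul_div_assoc]
    have hI : sz I < n / 2 := hI
    refine mul_le_mul_of_nonneg_left ?_ (pow_nonneg (by linarith) t)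
    rw [sz_compl]
    linarith
  -- Markov's inequality for the volume: half of the vertices carry volume at least `D n / 4`.
  · have h1 : ∀ I : Set V, ind {I | sz I < n / 2}ᶜ I ≤ 4 / (D * n) * wt (rdeg H) I := fun I => by
      by_cases hI : sz I < n / 2
      · have := wt_nonneg hd0 I
        have h2 : ind {I : Set V | sz I < n / 2}ᶜ I = 0 := by simp [ind, hI]
        rw [h2]; positivity
      · have h2 : ind {I : Set V | sz I < n / 2}ᶜ I = 1 := by
          simp only [ind]
          rw [Set.indicator_of_mem (by simpa using hI)]; rfl
        rw [h2, div_mul_eq_mul_div, le_div_iff₀ (by positivity)]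
        have h3 := hH.le_vol I
        have h4 : D / 2 * (n / 2) ≤ D / 2 * sz I :=
          mul_le_mul_of_nonneg_left (not_lt.1 hI) (by positivity)
        linarith
    refine (transition_iterate_mono pull _ s h1 {v}).trans ?_
    refine (transition_iterate_drift pull _ (R := Set.univ) (fun _ _ _ => trivial)
      (β := 1 + q) (by linarith) (fun I _ => ?_) s trivial).trans ?_
    · calc transition pull (roundMeasure H q) (fun I => 4 / (D * n) * wt (rdeg H) I) I
          = 4 / (D * n) * transition pull (roundMeasure H q) (wt (rdeg H)) I :=
            integral_const_mul _ _
        _ ≤ 4 / (D * n) * ((1 + q) * wt (rdeg H) I) := by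
            gcongr; exact transition_pull_vol_le H q hH.rdeg_pos I
        _ = _ := by ring
    · rw [wt_singleton]
      calc (1 + q : ℝ) ^ s * (4 / (D * n) * rdeg H v) ≤ (1 + q : ℝ) ^ s * (4 / (D * n) * D) := by
            gcongr; exact hH.rdeg_le v
        _ = _ := by field_simp

theorem WellSpread.grows_pull {x : ℝ} (hH : WellSpread H D x c) (hx : 0 < x)
    (hx4 : 4 * x ≤ 1) :
    Grows H q pull x (1 / (1 + q * (1 - 4 * x)) + 2 * x) := by
  refine ⟨rdeg H, D / 2, by linarith [hH.pos], hH.half_le_rdeg,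
    fun u => by linarith [hH.rdeg_le u], fun I hI hI2 => ?_⟩
  have h := hH.transition_pull_inv_vol_le_of_small q (K := 1 / x) (by positivity) hI hI2
    (by linarith)
  rwa [show 2 * (x + x) = 4 * x by ring, show 2 / (1 / x) = 2 * x by field_simp] at h

theorem WellSpread.grows_pushPull {x : ℝ} (hH : WellSpread H D x c) (hx : 0 < x)
    (hx4 : 4 * x ≤ 1) :
    Grows H 1 pushPull x (1 / (1 + 2 * (1 - 4 * x)) + 144 * x) := by
  classical
  have hD := hH.pos
  refine ⟨fun u => √(rdeg H u), √(D / 2), Real.sqrt_pos.2 (by linarith),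
    fun u => Real.sqrt_le_sqrt (hH.half_le_rdeg u), fun u => ?_, fun I hI hI2 => ?_⟩
  · refine Real.sqrt_le_iff.2 ⟨by positivity, (hH.rdeg_le u).trans ?_⟩
    rw [mul_pow, Real.sq_sqrt (by linarith)]
    linarith
  · have h := hH.transition_pushPull_inv_le_of_small (K := 1 / x) (by positivity) hI hI2
      (by linarith)
    refine h.trans (le_of_eq ?_)
    rw [show 2 * (x + x) = 4 * x by ring, show 16 / (1 / x) = 16 * x by field_simp]
    ring

end FixedGraph

/-! ### Runtimes -/

section Runtime

variable {V : Type*} {P : Protocol V}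

theorem monotone_informed (hP : ∀ ρ I, I ⊆ P ρ I) (v : V) (ω : ℕ → Round V) :
    Monotone (informed P v ω) :=
  monotone_nat_of_le_succ fun t => hP (ω t) _

theorem exists_runtime_eq (v : V) (ω : ℕ → Round V) {t₂ : ℕ}
    (h₂ : informed P v ω t₂ = Set.univ) :
    ∃ t : ℕ, runtime P v ω = t ∧ informed P v ω t = Set.univ ∧ t ≤ t₂ := by
  classical
  have hex : ∃ t, informed P v ω t = Set.univ := ⟨t₂, h₂⟩
  refine ⟨Nat.find hex, le_antisymm ?_ ?_, Nat.find_spec hex, Nat.find_min' hex h₂⟩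
  · exact iInf₂_le (f := fun (t : ℕ) (_ : informed P v ω t = Set.univ) => (t : ℕ∞)) _
      (Nat.find_spec hex)
  · exact le_iInf₂ fun t ht => Nat.cast_le.2 (Nat.find_min' hex ht)

theorem lt_of_informed_ne_univ (hP : ∀ ρ I, I ⊆ P ρ I) (v : V) (ω : ℕ → Round V) {t₁ t : ℕ}
    (h₁ : informed P v ω t₁ ≠ Set.univ) (h : informed P v ω t = Set.univ) : t₁ < t := by
  by_contra hlt
  have := monotone_informed hP v ω (not_lt.1 hlt)
  rw [h] at this
  exact h₁ (Set.univ_subset_iff.1 this)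

end Runtime

/-! ### Asymptotics -/

section Asymptotics

theorem tendsto_log_natCast : Tendsto (fun n : ℕ => Real.log n) atTop atTop :=
  Real.tendsto_log_atTop.comp tendsto_natCast_atTop_atTop

theorem tendsto_pow_ceil_log {β a : ℝ} (hβ : 0 ≤ β) (hβ1 : β < 1) (ha : 0 < a) :
    Tendsto (fun n : ℕ => β ^ ⌈a * Real.log n⌉₊) atTop (𝓝 0) :=
  (tendsto_pow_atTop_nhds_zero_of_lt_one hβ hβ1).comp
    (tendsto_nat_ceil_atTop.comp (tendsto_log_natCast.const_mul_atTop ha))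

theorem tendsto_pow_ceil_log_mul {β a : ℝ} (hβ : 0 < β) (hβ1 : β ≤ 1)
    (ha : a * Real.log β < -1) :
    Tendsto (fun n : ℕ => β ^ ⌈a * Real.log n⌉₊ * (n : ℝ)) atTop (𝓝 0) := by
  have hlim : Tendsto (fun n : ℕ => Real.exp ((1 + a * Real.log β) * Real.log n)) atTop (𝓝 0) :=
    Real.tendsto_exp_atBot.comp
      (tendsto_log_natCast.const_mul_atTop_of_neg (by linarith))
  refine squeeze_zero' (Eventually.of_forall fun n => by positivity) ?_ hlim
  filter_upwards [eventually_ge_atTop 1] with n hn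
  have hn0 : (0 : ℝ) < n := by exact_mod_cast hn
  have hlog : Real.log β ≤ 0 := Real.log_nonpos hβ.le hβ1
  rw [add_mul, one_mul, Real.exp_add, Real.exp_log hn0, mul_comm]
  gcongr
  rw [← Real.exp_log hβ, ← Real.exp_nat_mul, Real.log_exp]
  refine Real.exp_le_exp.2 ?_
  nlinarith [Nat.le_ceil (a * Real.log n)]

theorem tendsto_pow_ceil_log_div {b a : ℝ} (hb : 1 ≤ b) (ha : a * Real.log b < 1) :
    Tendsto (fun n : ℕ => b ^ ⌈a * Real.log n⌉₊ / (n : ℝ)) atTop (𝓝 0) := by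
  have hlogb : 0 ≤ Real.log b := Real.log_nonneg hb
  -- For negative `a` the natural ceiling is `0`, not close to `a log n`.
  set a' := max a 0 with ha'
  have ha1 : a' * Real.log b < 1 := by
    rcases le_total a 0 with h | h
    · rw [ha', max_eq_right h]; simp
    · rwa [ha', max_eq_left h]
  have hlim : Tendsto (fun n : ℕ => b * Real.exp ((a' * Real.log b - 1) * Real.log n)) atTop
      (𝓝 (b * 0)) :=
    (Real.tendsto_exp_atBot.comp
      (tendsto_log_natCast.const_mul_atTop_of_neg (by linarith))).const_mul b
  rw [mul_zero] at hlim
  refine squeeze_zero' (Eventually.of_forall fun n => by positivity) ?_ hlim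
  filter_upwards [eventually_ge_atTop 1] with n hn
  have hn0 : (0 : ℝ) < n := by exact_mod_cast hn
  have hn1 : 0 ≤ Real.log n := Real.log_natCast_nonneg n
  have hb0 : 0 < b := by linarith
  have hceil : (⌈a * Real.log n⌉₊ : ℝ) ≤ a' * Real.log n + 1 := by
    refine le_trans ?_ (Nat.ceil_lt_add_one (mul_nonneg (le_max_right _ _) hn1)).le
    exact_mod_cast Nat.ceil_mono (mul_le_mul_of_nonneg_right (le_max_left _ _) hn1)
  have h1 : b ^ ⌈a * Real.log n⌉₊ ≤ b * Real.exp (a' * Real.log b * Real.log n) := by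
    calc b ^ ⌈a * Real.log n⌉₊ = Real.exp (⌈a * Real.log n⌉₊ * Real.log b) := by
          rw [Real.exp_nat_mul, Real.exp_log hb0]
      _ ≤ Real.exp (Real.log b + a' * Real.log b * Real.log n) := by
          refine Real.exp_le_exp.2 ?_
          nlinarith
      _ = _ := by rw [Real.exp_add, Real.exp_log hb0]
  rw [sub_mul, one_mul, Real.exp_sub, Real.exp_log hn0, ← mul_div_assoc]
  gcongr

/-- Uniform estimates for every fixed error yield estimates with an error tending to zero. -/
theorem exists_tendsto_zero_of_eventually {Q : ℕ → ℝ → Prop}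
    (hmono : ∀ n a b, a ≤ b → Q n a → Q n b) (h : ∀ a, 0 < a → ∀ᶠ n in atTop, Q n a) :
    ∃ δ : ℕ → ℝ, (∀ n, 0 ≤ δ n) ∧ Tendsto δ atTop (𝓝 0) ∧ ∀ᶠ n in atTop, Q n (δ n) := by
  set i : ℕ → ℝ := fun n => sInf {a | 0 < a ∧ Q n a} with hi
  have hi0 : ∀ n, 0 ≤ i n := fun n => Real.sInf_nonneg fun a ha => ha.1.le
  have hbdd : ∀ n, BddBelow {a | 0 < a ∧ Q n a} := fun n => ⟨0, fun a ha => ha.1.le⟩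
  have hilim : Tendsto i atTop (𝓝 0) := by
    refine tendsto_order.2 ⟨fun a ha => Eventually.of_forall fun n => ha.trans_le (hi0 n),
      fun a ha => ?_⟩
    filter_upwards [h (a / 2) (half_pos ha)] with n hn
    exact (csInf_le (hbdd n) ⟨half_pos ha, hn⟩).trans_lt (half_lt_self ha)
  -- The infimum of the admissible errors need not be admissible; any larger number is, by
  -- monotonicity.
  refine ⟨fun n => i n + 1 / ((n : ℝ) + 1), fun n => add_nonneg (hi0 n) (by positivity), ?_, ?_⟩
  · simpa using hilim.add tendsto_one_div_add_atTop_nhds_zero_nat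
  · filter_upwards [h 1 one_pos] with n hn
    have hpos : (0 : ℝ) < 1 / ((n : ℝ) + 1) := by positivity
    obtain ⟨a, ha, hlt⟩ := exists_lt_of_csInf_lt (s := {a | 0 < a ∧ Q n a}) ⟨1, one_pos, hn⟩
      (show i n < i n + 1 / ((n : ℝ) + 1) by linarith)
    exact hmono n a _ hlt.le ha.2

/-- For `q < 1` this is continuity at `x = 0`. For `q = 1` the convention `log 0 = 0` makes the
coefficient equal to `a`, while `log (4x)` tends to `-∞`: the last phase then takes an arbitrarily
small multiple of `log n`. -/
theorem eventually_log_one_sub_mul {q a : ℝ} (hq0 : 0 < q) (hq1 : q ≤ 1) (ha : 0 < a) :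
    ∀ᶠ x in 𝓝[>] (0 : ℝ), 0 < 1 - q * (1 - 4 * x) ∧ 1 - q * (1 - 4 * x) ≤ 1 ∧
      (-(1 / Real.log (1 - q)) + a) * Real.log (1 - q * (1 - 4 * x)) < -1 := by
  have hcont : Tendsto (fun x : ℝ => 1 - q * (1 - 4 * x)) (𝓝[>] 0) (𝓝 (1 - q)) := by
    have : ContinuousAt (fun x : ℝ => 1 - q * (1 - 4 * x)) 0 := by fun_prop
    have h := this.tendsto
    simp only [mul_zero, sub_zero, mul_one] at h
    exact h.mono_left nhdsWithin_le_nhds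
  have hpos : ∀ᶠ x in 𝓝[>] (0 : ℝ), 0 < 1 - q * (1 - 4 * x) := by
    filter_upwards [self_mem_nhdsWithin] with x hx
    have := mul_pos hq0 (Set.mem_Ioi.1 hx)
    linarith
  have hle : ∀ᶠ x in 𝓝[>] (0 : ℝ), 1 - q * (1 - 4 * x) ≤ 1 :=
    (hcont.eventually (gt_mem_nhds (show 1 - q < 1 by linarith))).mono fun x hx => hx.le
  have hlim : ∀ᶠ x in 𝓝[>] (0 : ℝ),
      (-(1 / Real.log (1 - q)) + a) * Real.log (1 - q * (1 - 4 * x)) < -1 := by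
    rcases hq1.eq_or_lt with rfl | hq1
    · have h1 : Tendsto (fun x : ℝ => 1 - 1 * (1 - 4 * x)) (𝓝[>] 0) (𝓝[>] 0) :=
        tendsto_nhdsWithin_iff.2 ⟨by simpa using hcont, hpos⟩
      have h2 := (Real.tendsto_log_nhdsGT_zero.comp h1).const_mul_atBot ha
      filter_upwards [h2.eventually (eventually_lt_atBot (-1))] with x hx
      simpa using hx
    · have hl : Real.log (1 - q) < 0 := Real.log_neg (by linarith) (by linarith)
      have h1 := (hcont.log (by linarith)).const_mul (-(1 / Real.log (1 - q)) + a)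
      refine h1.eventually (gt_mem_nhds ?_)
      rw [add_mul, neg_mul, one_div, inv_mul_cancel₀ hl.ne]
      nlinarith
  filter_upwards [hpos, hle, hlim] with x h1 h2 h3 using ⟨h1, h2, h3⟩

end Asymptotics

/-! ### Bounds for sequences of graphs -/

section Sequences

variable {ε : ℝ} {q : unitInterval}
  {G G' : ∀ n : ℕ, SimpleGraph (Fin n)}
  [∀ n, DecidableRel (G n).Adj] [∀ n, DecidableRel (G' n).Adj]

/-- All vertices are informed after the time for the growth of the informed set by the factor
`1 / b` per round and the time for informing the last vertices by pull. -/
theorem IsExpanderSequence.eventually_informed (hG : IsExpanderSequence G) (hε : 0 < ε)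
    (hε' : ε < 1 / 2) (hG' : ∀ n, IsEdgeDeletion (G n) (G' n) (1 / 2 + ε)) (hq : 0 < q)
    {P : ∀ n, Protocol (Fin n)} (hP : ∀ n ρ I, pull ρ I ⊆ P n ρ I) {β : ℝ → ℝ} {b : ℝ}
    (hb0 : 0 < b) (hb1 : b < 1) (hβ : Tendsto β (𝓝[>] 0) (𝓝 b))
    (hgr : ∀ n x D, WellSpread (G' n) D x (ε / 2) → 0 < x → 4 * x ≤ 1 →
      Grows (G' n) q (P n) x (β x)) {a : ℝ} (ha : 0 < a) :
    ∀ᶠ n : ℕ in atTop, ∀ v : Fin n, (processMeasure (G' n) q).real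
      {ω | informed (P n) v ω
        ⌊(-(1 / Real.log b) - 1 / Real.log (1 - q) + a) * Real.log n⌋₊ ∈ ({Set.univ}ᶜ : Set _)} ≤
          a := by
  have hq0 : (0 : ℝ) < q := hq
  have hq1 : (q : ℝ) ≤ 1 := q.2.2
  have hlogb : Real.log b < 0 := Real.log_neg hb0 hb1
  set c₁ := -(1 / Real.log b) with hc₁
  set c₃ := -(1 / Real.log (1 - q)) with hc₃
  have hc₁0 : 0 < c₁ := by rw [hc₁, neg_pos]; exact one_div_neg.2 hlogb
  have hc₃0 : 0 ≤ c₃ := by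
    rw [hc₃, neg_nonneg]
    exact one_div_nonpos.2 (Real.log_nonpos (by linarith) (by linarith))
  -- Each of the four phases gets the slack `d log n`; the fifth share absorbs the four roundings.
  set d := a / 5 with hd
  have hd0 : 0 < d := by positivity
  have hβlog : ∀ᶠ x in 𝓝[>] (0 : ℝ), (c₁ + d) * Real.log (β x) < -1 := by
    refine ((hβ.log hb0.ne').const_mul (c₁ + d)).eventually (gt_mem_nhds ?_)
    rw [add_mul, hc₁, neg_mul, one_div, inv_mul_cancel₀ hlogb.ne]
    nlinarith
  -- `x` is fixed before `n` grows, so close to `0` that both sharp rates are within the slack `d`.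
  obtain ⟨x, ⟨h3pos, h3le, h3log⟩, h1log, h1pos, h1le, hx0, hxε⟩ :=
    ((eventually_log_one_sub_mul hq0 hq1 hd0).and (hβlog.and
      ((hβ.eventually (lt_mem_nhds hb0)).and ((hβ.eventually (gt_mem_nhds hb1)).and
        (Ioo_mem_nhdsGT (show 0 < ε / 4 by positivity)))))).exists
  have hx1 : x ≤ 1 := by linarith
  set t₀ : ℕ → ℕ := fun n => ⌈d * Real.log n⌉₊ with ht₀
  set t₁ : ℕ → ℕ := fun n => ⌈(c₁ + d) * Real.log n⌉₊ with ht₁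
  set t₃ : ℕ → ℕ := fun n => ⌈(c₃ + d) * Real.log n⌉₊ with ht₃
  have hqε : 0 < q * (ε / 2) ∧ q * (ε / 2) ≤ 1 :=
    ⟨by positivity, mul_le_one₀ hq1 (by positivity) (by linarith)⟩
  have hqεx : 0 < q * (ε / 2) * x ∧ q * (ε / 2) * x ≤ 1 :=
    ⟨mul_pos hqε.1 hx0, mul_le_one₀ hqε.2 hx0.le hx1⟩
  have hlim : Tendsto (fun n : ℕ => (1 - q * (ε / 2) / 16) ^ t₀ n * (2 / x) +
      (2 * (β x ^ t₁ n * (n : ℝ)) + ((1 - q * (ε / 2) * x) ^ t₀ n * (2 / x) +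
        (1 - q * (1 - 4 * x)) ^ t₃ n * (n : ℝ)))) atTop (𝓝 (0 * (2 / x) + (2 * 0 +
          (0 * (2 / x) + 0)))) := by
    refine ((tendsto_pow_ceil_log (by linarith) (by linarith) hd0).mul_const _).add
      (((tendsto_pow_ceil_log_mul h1pos h1le.le h1log).const_mul _).add
      (((tendsto_pow_ceil_log (by linarith) (by linarith) hd0).mul_const _).add
      (tendsto_pow_ceil_log_mul h3pos h3le h3log)))
  simp only [zero_mul, mul_zero, add_zero] at hlim
  filter_upwards [hlim.eventually (gt_mem_nhds ha),
    hG.eventually_wellSpread hε hε' hG' hx0 hxε.le,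
    tendsto_natCast_atTop_atTop.eventually (eventually_ge_atTop (2 / x)),
    tendsto_log_natCast.eventually (eventually_ge_atTop (4 / d))] with n h1 h2 h3 h4 v
  have hlog0 : 0 ≤ Real.log n := Real.log_natCast_nonneg n
  have hT : t₀ n + (t₁ n + (t₀ n + t₃ n)) ≤ ⌊(c₁ - 1 / Real.log (1 - q) + a) * Real.log n⌋₊ := by
    refine Nat.le_floor ?_
    push_cast
    have e0 : (t₀ n : ℝ) < d * Real.log n + 1 := Nat.ceil_lt_add_one (by positivity)
    have e1 : (t₁ n : ℝ) < (c₁ + d) * Real.log n + 1 := Nat.ceil_lt_add_one (by positivity)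
    have e3 : (t₃ n : ℝ) < (c₃ + d) * Real.log n + 1 := Nat.ceil_lt_add_one (by positivity)
    have e4 : 4 ≤ d * Real.log n := by rw [div_le_iff₀ hd0] at h4; linarith
    have e5 : c₁ - 1 / Real.log (1 - q) + a = c₁ + c₃ + 5 * d := by rw [hc₃, hd]; ring
    rw [e5]
    linarith
  have hPm : ∀ ρ (I : Set (Fin n)), I ⊆ P n ρ I := fun ρ I => (subset_pull ρ I).trans (hP n ρ I)
  refine (measureReal_mono (s₂ := {ω | informed (P n) v ω (t₀ n + (t₁ n + (t₀ n + t₃ n))) ∈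
    ({Set.univ}ᶜ : Set _)}) ?_).trans ?_
  · refine fun ω hω hu => hω ?_
    have := monotone_informed hPm v ω hT
    rw [Set.mem_singleton_iff.1 hu] at this
    exact Set.univ_subset_iff.1 this
  · rw [measureReal_informed]
    refine (h2.transition_iterate_ne_univ_le q (hP n) (by positivity) (by linarith)
      (hgr n x _ h2 hx0 (by linarith)) h1pos.le hx0 hx1 (by simpa using h3) (t₀ n) (t₁ n) (t₀ n)
      (t₃ n) v).trans ?_
    refine le_trans (le_of_eq ?_) h1.le
    simp only [Fintype.card_fin]
    ring

/-- With pull, some vertex is still uninformed shortly before the expected runtime. -/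
theorem IsExpanderSequence.eventually_not_informed (hG : IsExpanderSequence G) (hε : 0 < ε)
    (hε' : ε < 1 / 2) (hG' : ∀ n, IsEdgeDeletion (G n) (G' n) (1 / 2 + ε)) (hq : 0 < q)
    {a : ℝ} (ha : 0 < a) :
    ∀ᶠ n : ℕ in atTop, ∀ v : Fin n, (processMeasure (G' n) q).real
      {ω | informed pull v ω
        ⌊(1 / Real.log (1 + q) - 1 / Real.log (1 - q) - a) * Real.log n⌋₊ ∈ ({Set.univ} : Set _)} ≤
          a := by
  have hq0 : (0 : ℝ) < q := hq
  have hq1 : (q : ℝ) ≤ 1 := q.2.2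
  have hlogq : 0 < Real.log (1 + q) := Real.log_pos (by linarith)
  set c₁ := 1 / Real.log (1 + q) with hc₁
  set c₃ := -(1 / Real.log (1 - q)) with hc₃
  -- Growth and final phase are each shortened by `d log n`.
  set d := a / 2 with hd
  have hd0 : 0 < d := by positivity
  set s : ℕ → ℕ := fun n => ⌈(c₁ - d) * Real.log n⌉₊ with hs
  set t : ℕ → ℕ := fun n => ⌈(c₃ - d) * Real.log n⌉₊ with ht
  have hlim1 : Tendsto (fun n : ℕ => (1 + q : ℝ) ^ s n / (n : ℝ)) atTop (𝓝 0) := by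
    refine tendsto_pow_ceil_log_div (by linarith) ?_
    rw [sub_mul, hc₁, one_div, inv_mul_cancel₀ hlogq.ne']
    nlinarith
  have hlim2 : Tendsto (fun n : ℕ => (1 - q : ℝ) ^ t n * (n : ℝ)) atTop atTop := by
    rcases hq1.eq_or_lt with h | h
    -- For `q = 1`, `log 0 = 0` gives `c₃ = 0`, so the final phase has no rounds and `(1 - q) ^ 0 =
    -- 1`.
    · have ht0 : ∀ n, t n = 0 := fun n => by
        simp only [ht, hc₃, h, Nat.ceil_eq_zero]
        refine mul_nonpos_of_nonpos_of_nonneg ?_ (Real.log_natCast_nonneg n)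
        simpa using hd0.le
      simp only [ht0, pow_zero, one_mul]
      exact tendsto_natCast_atTop_atTop
    · have hl : Real.log (1 - q) < 0 := Real.log_neg (by linarith) (by linarith)
      have h0 : Tendsto (fun n : ℕ => (1 / (1 - q) : ℝ) ^ t n / (n : ℝ)) atTop (𝓝 0) := by
        refine tendsto_pow_ceil_log_div ?_ ?_
        · rw [le_div_iff₀ (by linarith)]; linarith
        · rw [one_div, Real.log_inv, hc₃, sub_mul, neg_mul_neg, one_div, inv_mul_cancel₀ hl.ne]
          nlinarith
      have h1 : Tendsto (fun n : ℕ => (1 / (1 - q) : ℝ) ^ t n / (n : ℝ)) atTop (𝓝[>] 0) := by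
        refine tendsto_nhdsWithin_iff.2 ⟨h0, ?_⟩
        filter_upwards [eventually_ge_atTop 1] with n hn
        have hn0 : (0 : ℝ) < n := by exact_mod_cast hn
        have : (0 : ℝ) < 1 - q := by linarith
        exact Set.mem_Ioi.2 (by positivity)
      refine (tendsto_inv_nhdsGT_zero.comp h1).congr fun n => ?_
      simp [div_eq_mul_inv, mul_comm]
  have hlim : Tendsto (fun n : ℕ => 4 * ((1 + q : ℝ) ^ s n / (n : ℝ)) +
      Real.exp (-((1 - q : ℝ) ^ t n * (n : ℝ) / 2))) atTop (𝓝 (4 * 0 + 0)) := by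
    refine (hlim1.const_mul 4).add ?_
    exact Real.tendsto_exp_neg_atTop_nhds_zero.comp (hlim2.atTop_div_const two_pos)
  simp only [mul_zero, add_zero] at hlim
  filter_upwards [hlim.eventually (gt_mem_nhds ha),
    hG.eventually_wellSpread hε hε' hG' (show 0 < ε / 4 by positivity) le_rfl,
    eventually_ge_atTop 1] with n h1 h2 h3 v
  have hn0 : (0 : ℝ) < n := by exact_mod_cast h3
  have hT : ⌊(c₁ - 1 / Real.log (1 - q) - a) * Real.log n⌋₊ ≤ s n + t n := by
    refine Nat.floor_le_of_le ?_
    push_cast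
    have e1 : (c₁ - d) * Real.log n ≤ s n := Nat.le_ceil _
    have e2 : (c₃ - d) * Real.log n ≤ t n := Nat.le_ceil _
    have e3 : c₁ - 1 / Real.log (1 - q) - a = (c₁ - d) + (c₃ - d) := by rw [hc₃, hd]; ring
    rw [e3]
    linarith
  refine (measureReal_mono (s₂ := {ω | informed pull v ω (s n + t n) ∈ ({Set.univ} : Set _)})
    fun ω hω => ?_).trans ?_
  · have := monotone_informed subset_pull v ω hT
    rw [Set.mem_singleton_iff.1 hω] at this
    exact Set.univ_subset_iff.1 this
  · rw [measureReal_informed]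
    refine (h2.transition_iterate_pull_univ_le q (by simpa using hn0) (s n) (t n) v).trans ?_
    simpa only [Fintype.card_fin] using h1.le

/-- From estimates with an arbitrary multiple of `log n` as error to an error `o(log n)`. -/
theorem exists_isLittleO_log_of_eventually {Ω : ℕ → Type*} [∀ n, MeasurableSpace (Ω n)]
    {μ : ∀ n, Measure (Ω n)} [∀ n, IsFiniteMeasure (μ n)] {E : ∀ n, Fin n → ℝ → Set (Ω n)}
    (hE : ∀ n v, Monotone (E n v))
    (h : ∀ a, 0 < a → ∀ᶠ n : ℕ in atTop, ∀ v, 1 - 2 * a ≤ (μ n).real (E n v (a * Real.log n))) :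
    ∃ g : ℕ → ℝ, (∀ n, 0 < g n) ∧ g =o[atTop] (fun n : ℕ => Real.log n) ∧
      ∀ η : ℝ, 0 < η → ∀ᶠ n : ℕ in atTop, ∀ v, 1 - η ≤ (μ n).real (E n v (g n)) := by
  obtain ⟨δ, hδ0, hδ, hQ⟩ := exists_tendsto_zero_of_eventually
    (Q := fun n a => ∀ v, 1 - 2 * a ≤ (μ n).real (E n v (a * Real.log n)))
    (fun n a b hab ha v => by
      have h1 := measureReal_mono (μ := μ n)
        (hE n v (mul_le_mul_of_nonneg_right hab (Real.log_natCast_nonneg n)))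
      linarith [ha v]) h
  have hlog0 : ∀ n : ℕ, 0 ≤ Real.log n := Real.log_natCast_nonneg
  -- The summand `1` only ensures positivity.
  refine ⟨fun n => δ n * Real.log n + 1, fun n => by have := hδ0 n; have := hlog0 n; positivity,
    ?_, fun η hη => ?_⟩
  · refine IsLittleO.add ?_ ?_
    · have h1 : δ =o[atTop] (fun _ => (1 : ℝ)) := (isLittleO_one_iff ℝ).2 hδ
      simpa using h1.mul_isBigO (isBigO_refl (fun n : ℕ => Real.log n) atTop)
    · refine (isLittleO_const_left).2 (Or.inr ?_)
      exact tendsto_norm_atTop_atTop.comp tendsto_log_natCast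
  · filter_upwards [hQ, hδ.eventually (gt_mem_nhds (half_pos hη))] with n h1 h2 v
    have h3 := measureReal_mono (μ := μ n) (hE n v (show δ n * Real.log n ≤ δ n * Real.log n + 1 by
      linarith))
    linarith [h1 v]

end Sequences

end

end RumorSpreading

/-! ### Assembly of the two runtime statements -/

open RumorSpreading

theorem mainTheorem1 (ε : ℝ) (hε : 0 < ε) (hε' : ε < 1 / 2) (q : unitInterval) (hq : 0 < q)
    (G G' : ∀ n : ℕ, SimpleGraph (Fin n))
    [∀ n, DecidableRel (G n).Adj] [∀ n, DecidableRel (G' n).Adj]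
    (hG : RumorSpreading.IsExpanderSequence G)
    (hG' : ∀ n, RumorSpreading.IsEdgeDeletion (G n) (G' n) (1 / 2 + ε)) :
    -- (a): `T_pull(G'_n, q) = c_pull(q) log n + o(log n)` whp, uniformly in the initial vertex
    (∃ g : ℕ → ℝ, (∀ n, 0 < g n) ∧ g =o[atTop] (fun n : ℕ => Real.log n) ∧
      ∀ η : ℝ, 0 < η → ∀ᶠ n : ℕ in atTop, ∀ v : Fin n,
        1 - η ≤ (RumorSpreading.processMeasure (G' n) q).real
          {ω | ∃ t : ℕ, RumorSpreading.runtime RumorSpreading.pull v ω = (t : ℕ∞) ∧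
            |(t : ℝ) - RumorSpreading.cPull q * Real.log n| ≤ g n}) ∧
    -- (b): `T_pp(G'_n, 1) ≤ c_pp(1) log n + o(log n)` whp, if `δ(G_n) ≥ α n`
    (∀ α : ℝ, 0 < α → α ≤ 1 → (∀ᶠ n : ℕ in atTop, α * (n : ℝ) ≤ ((G n).minDegree : ℝ)) →
      ∃ g : ℕ → ℝ, (∀ n, 0 < g n) ∧ g =o[atTop] (fun n : ℕ => Real.log n) ∧
        ∀ η : ℝ, 0 < η → ∀ᶠ n : ℕ in atTop, ∀ v : Fin n,
          1 - η ≤ (RumorSpreading.processMeasure (G' n) 1).real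
            {ω | ∃ t : ℕ, RumorSpreading.runtime RumorSpreading.pushPull v ω = (t : ℕ∞) ∧
              (t : ℝ) ≤ RumorSpreading.cPushPull 1 * Real.log n + g n}) := by
  have hq0 : (0 : ℝ) < q := hq
  constructor
  -- At `q = 1` the general formula agrees with the limit value, since `1 / log 0 = 0`.
  · have hc : cPull q = 1 / Real.log (1 + q) - 1 / Real.log (1 - q) := by
      unfold cPull
      split_ifs with h
      · rw [h]; norm_num
      · rfl
    refine exists_isLittleO_log_of_eventually
      (E := fun n v r => {ω | ∃ t : ℕ, runtime pull v ω = (t : ℕ∞) ∧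
        |(t : ℝ) - cPull q * Real.log n| ≤ r})
      (fun n v r r' hr ω ⟨t, h1, h2⟩ => ⟨t, h1, h2.trans hr⟩) fun a ha => ?_
    have hβ : Tendsto (fun x : ℝ => 1 / (1 + q * (1 - 4 * x)) + 2 * x) (𝓝[>] 0)
        (𝓝 (1 / (1 + q))) := by
      have hcont : ContinuousAt (fun x : ℝ => 1 / (1 + q * (1 - 4 * x)) + 2 * x) 0 := by
        refine ContinuousAt.add (continuousAt_const.div (by fun_prop) ?_) (by fun_prop)
        simp only [mul_zero, sub_zero, mul_one]
        linarith
      have h := hcont.tendsto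
      simp only [mul_zero, sub_zero, mul_one, add_zero] at h
      exact h.mono_left nhdsWithin_le_nhds
    have hup := hG.eventually_informed hε hε' hG' hq (P := fun _ => pull)
      (fun _ _ _ => Set.Subset.rfl) (b := 1 / (1 + q)) (by positivity)
      (by rw [div_lt_one (by linarith)]; linarith) hβ
      (fun n x D hH hx hx4 => hH.grows_pull q hx hx4) ha
    have hlow := hG.eventually_not_informed hε hε' hG' hq ha
    have hc' : -(1 / Real.log (1 / (1 + q))) - 1 / Real.log (1 - q) = cPull q := by
      rw [hc, one_div (1 + (q : ℝ)), Real.log_inv]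
      simp
    rw [hc'] at hup
    rw [← hc] at hlow
    filter_upwards [hup, hlow] with n h1 h2 v
    have h3 := measureReal_union_le (μ := processMeasure (G' n) q)
    set T₂ := ⌊(cPull q + a) * Real.log n⌋₊
    set T₁ := ⌊(cPull q - a) * Real.log n⌋₊
    set A := {ω | informed pull v ω T₂ ∈ ({Set.univ}ᶜ : Set (Set (Fin n)))}
    set B := {ω | informed pull v ω T₁ ∈ ({Set.univ} : Set (Set (Fin n)))}
    set E := {ω : ℕ → Round (Fin n) | ∃ t : ℕ, runtime pull v ω = (t : ℕ∞) ∧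
      |(t : ℝ) - cPull q * Real.log n| ≤ a * Real.log n}
    have hcov : (Set.univ : Set (ℕ → Round (Fin n))) ⊆ E ∪ (A ∪ B) := by
      intro ω _
      by_cases hA : ω ∈ A
      · exact Or.inr (Or.inl hA)
      by_cases hB : ω ∈ B
      · exact Or.inr (Or.inr hB)
      left
      have hA' : informed pull v ω T₂ = Set.univ := not_not.1 hA
      obtain ⟨t, ht, hu, hle⟩ := exists_runtime_eq v ω hA'
      have hlt := lt_of_informed_ne_univ subset_pull v ω hB hu
      have hlog0 : 0 ≤ Real.log n := Real.log_natCast_nonneg n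
      refine ⟨t, ht, abs_le.2 ⟨?_, ?_⟩⟩
      -- The runtime exceeds `T₁`, hence is at least `T₁ + 1`, which compensates the floor; this
      -- also covers a negative argument.
      · have e1 := Nat.lt_floor_add_one ((cPull q - a) * Real.log n)
        have e2 : (T₁ : ℝ) + 1 ≤ t := by exact_mod_cast hlt
        linarith
      · have hc0 : 0 ≤ cPull q := by
          rw [hc]
          have i1 : 0 ≤ 1 / Real.log (1 + q) := one_div_nonneg.2 (Real.log_nonneg (by linarith))
          have i2 : 1 / Real.log (1 - q) ≤ 0 :=
            one_div_nonpos.2 (Real.log_nonpos (by linarith [q.2.2]) (by linarith))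
          linarith
        have e1 : (T₂ : ℝ) ≤ (cPull q + a) * Real.log n := Nat.floor_le (by positivity)
        have e2 : (t : ℝ) ≤ T₂ := by exact_mod_cast hle
        linarith
    have h4 : (processMeasure (G' n) q).real Set.univ ≤ _ := measureReal_mono hcov
    rw [probReal_univ] at h4
    have h5 := h3 E (A ∪ B)
    have h6 := h3 A B
    have h7 : (processMeasure (G' n) q).real A ≤ a := h1 v
    have h8 : (processMeasure (G' n) q).real B ≤ a := h2 v
    change 1 - 2 * a ≤ (processMeasure (G' n) q).real E
    linarith
  · intro _ _ _ _
    have hc : cPushPull 1 = 1 / Real.log 3 := by simp [cPushPull]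
    have hc0 : 0 ≤ cPushPull 1 := by
      rw [hc]; exact one_div_nonneg.2 (Real.log_nonneg (by norm_num))
    refine exists_isLittleO_log_of_eventually
      (E := fun n v r => {ω | ∃ t : ℕ, runtime pushPull v ω = (t : ℕ∞) ∧
        (t : ℝ) ≤ cPushPull 1 * Real.log n + r})
      (fun n v r r' hr ω ⟨t, h1, h2⟩ => ⟨t, h1, h2.trans (by linarith)⟩) fun a ha => ?_
    have hβ : Tendsto (fun x : ℝ => 1 / (1 + 2 * (1 - 4 * x)) + 144 * x) (𝓝[>] 0)
        (𝓝 (1 / 3)) := by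
      have hcont : ContinuousAt (fun x : ℝ => 1 / (1 + 2 * (1 - 4 * x)) + 144 * x) 0 :=
        ContinuousAt.add (continuousAt_const.div (by fun_prop) (by norm_num)) (by fun_prop)
      have h := hcont.tendsto
      norm_num at h
      simpa using h.mono_left nhdsWithin_le_nhds
    -- Push matters only for the growth rate `3`; in the other phases push&pull is bounded by pull.
    -- The contribution `1 / log 0` of the last phase vanishes.
    have hup := hG.eventually_informed hε hε' hG' (q := 1) one_pos (P := fun _ => pushPull)
      (fun _ => pull_subset_pushPull) (b := 1 / 3) (by norm_num) (by norm_num) hβ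
      (fun n x D hH hx hx4 => hH.grows_pushPull hx hx4) ha
    have hc' : -(1 / Real.log (1 / 3)) - 1 / Real.log (1 - ((1 : unitInterval) : ℝ)) =
        cPushPull 1 := by
      rw [hc, one_div (3 : ℝ), Real.log_inv]
      simp
    rw [hc'] at hup
    filter_upwards [hup] with n h1 v
    have h3 := measureReal_union_le (μ := processMeasure (G' n) 1)
    set T₂ := ⌊(cPushPull 1 + a) * Real.log n⌋₊
    set A := {ω | informed pushPull v ω T₂ ∈ ({Set.univ}ᶜ : Set (Set (Fin n)))}
    set E := {ω : ℕ → Round (Fin n) | ∃ t : ℕ, runtime pushPull v ω = (t : ℕ∞) ∧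
      (t : ℝ) ≤ cPushPull 1 * Real.log n + a * Real.log n}
    have hcov : (Set.univ : Set (ℕ → Round (Fin n))) ⊆ E ∪ A := by
      intro ω _
      by_cases hA : ω ∈ A
      · exact Or.inr hA
      left
      have hA' : informed pushPull v ω T₂ = Set.univ := not_not.1 hA
      obtain ⟨t, ht, hu, hle⟩ := exists_runtime_eq v ω hA'
      have hlog0 : 0 ≤ Real.log n := Real.log_natCast_nonneg n
      have e1 : (T₂ : ℝ) ≤ (cPushPull 1 + a) * Real.log n := Nat.floor_le (by positivity)
      have e2 : (t : ℝ) ≤ T₂ := by exact_mod_cast hle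
      exact ⟨t, ht, by linarith⟩
    have h4 : (processMeasure (G' n) 1).real Set.univ ≤ _ := measureReal_mono hcov
    rw [probReal_univ] at h4
    have h5 := h3 E A
    have h7 : (processMeasure (G' n) 1).real A ≤ a := h1 v
    change 1 - 2 * a ≤ (processMeasure (G' n) 1).real E
    linarith
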